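/- For $n\ge 3$ let $L_n$ be the connection Laplacian of the one-dimensional simplicial complex of the circular graph $C_n$: the $2n\times 2n$ matrix indexed by the vertices and edges of $C_n$ with entry $1$ if the two simplices intersect and $0$ otherwise. Let $\zeta_n(s)=\sum_\lambda \lambda^{-s}$, the sum running over the eigenvalues $\lambda$ of $L_n^2$ with multiplicity. With $f_\pm(y)=\frac{y\pm\sqrt{y^2+4}}{2}$ (the two solutions $x$ of $x-1/x=y$), define for $s\in\mathbb C$ $$ z(s)=\int_0^1 \Big( \big(f_+(4\sin^2\pi x)^2\big)^s+\big(f_-(4\sin^2\pi x)^2\big)^s\Big)\,dx, \qquad \zeta(s)=\frac{\pi}{2}\, z\!\left(\frac s2\right). $$ Theorem (limiting zeta function). For every $s\in\mathbb C$, $\lim_{n\to\infty}\zeta_n(s)/n=z(s)$, so that $z$ is the limiting zeta function and $\zeta$ its normalization. This function can be written in the following ways; all the integrals below converge absolutely. (a) Hypergeometric series: for every $s\in\mathbb C$, $$\zeta(2s)=\pi\;{}_4F_3\!\left(\tfrac14,\tfrac34,-s,s;\tfrac12,\tfrac12,1;-4\right).$$ Here the right-hand side is $\pi F(-4)$, where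 $F$ is the holomorphic function on $\mathbb C\setminus[1,\infty)$ (it exists and is unique) with $$F(w)=\sum_{n=0}^\infty \frac{(1/4)_n(3/4)_n(-s)_n(s)_n}{(1/2)_n(1/2)_n(1)_n}\,\frac{w^n}{n!}\qquad(|w|<1),$$ and $(c)_n=c(c+1)\cdots(c+n-1)$. (b) Cosine transform: the density $h(y)=\sqrt{\frac{\cosh(y)\coth(y)}{2-\sinh(y)}}$ is smooth on $(0,\log(2+\sqrt5))$, and for every $t\in\mathbb C$ (in particular for real $t$, that is, on the imaginary axis) $$\zeta(it)=\int_0^{\log(2+\sqrt5)}\cos(ty)\,h(y)\,dy .$$ (c) Original expression: for every $t\in\mathbb C$, $$ z(it)=\tfrac{2}{\pi}\,\zeta(2it)=\int_0^1 2\cos\!\Big(t\log\big((\sqrt{4\sin^4(\pi x)+1}+2\sin^2(\pi x))^2\big)\Big)\,dx .$$ (d) Simplest integral: for every $t\in\mathbb C$, $$ z(it)=\tfrac{2}{\pi}\,\zeta(2it)=\int_0^1 \frac{2\cos\!\big(2t\log(\sqrt{4v^2+1}+2v)\big)}{\pi\sqrt{1-v}\sqrt v}\,dv .$$ (e) Abelian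 integral: with $a=2+\sqrt5$, for every $s\in\mathbb C$, $$\zeta(s)=\int_1^a\frac{(z^2+1)\,z^{-1-s}\,(1+z^{2s})}{2\sqrt{(1+z)(1-z)(z-a)(z+1/a)}}\;dz .$$ -/

import Mathlib

open Filter Topology
open scoped Nat ContDiff

noncomputable section

/-! ### Connection Laplacians, spectral zeta functions, circular graphs -/

/-- The connection Laplacian of a finite set `G` of simplices: the entry at `(x, y)` is `1` if the
simplices `x` and `y` intersect and `0` otherwise. -/
def connectionLaplacian (G : Finset (Finset ℕ)) : Matrix G G ℝ :=
  Matrix.of fun x y => if Disjoint (x : Finset ℕ) (y : Finset ℕ) then 0 else 1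

/-- The spectral zeta function `∑ λ ^ (-s)` of a real square matrix with positive real spectrum;
the sum runs over the eigenvalues, that is, the roots of the characteristic polynomial,
counted with multiplicity. -/
def spectralZeta {ι : Type*} [Fintype ι] [DecidableEq ι] (A : Matrix ι ι ℝ) (s : ℂ) : ℂ :=
  (A.charpoly.roots.map fun l : ℝ => (l : ℂ) ^ (-s)).sum

/-- The one-dimensional simplicial complex of the circular graph `C_n` (for `3 ≤ n`): vertices
`0, …, n - 1` and edges joining `k` to `k + 1` modulo `n`. -/
def circularComplex (n : ℕ) : Finset (Finset ℕ) :=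
  (Finset.range n).image (fun k => {k}) ∪ (Finset.range n).image (fun k => {k, (k + 1) % n})

/-- The zeta function of the squared connection Laplacian of `C_n`. -/
def circularZeta (n : ℕ) (s : ℂ) : ℂ :=
  spectralZeta (connectionLaplacian (circularComplex n) ^ 2) s

/-! ### The limiting zeta function -/

/-- The positive solution `x` of `x - 1 / x = y`. -/
def fPlus (y : ℝ) : ℝ := (y + √(y ^ 2 + 4)) / 2

/-- The negative solution `x` of `x - 1 / x = y`. -/
def fMinus (y : ℝ) : ℝ := (y - √(y ^ 2 + 4)) / 2

/-- The limiting function in the unnormalised variable of the squared Laplacian: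
`z(s) = ∫₀¹ (f₊(4 sin² πx)²)^s + (f₋(4 sin² πx)²)^s dx`. -/
def limitZ (s : ℂ) : ℂ :=
  ∫ x in (0 : ℝ)..1,
    (((fPlus (4 * Real.sin (Real.pi * x) ^ 2) ^ 2 : ℝ) : ℂ) ^ s +
      ((fMinus (4 * Real.sin (Real.pi * x) ^ 2) ^ 2 : ℝ) : ℂ) ^ s)

/-- The normalised limiting zeta function `ζ(s) = (π / 2) z(s / 2)`. -/
def limitZeta (s : ℂ) : ℂ := (Real.pi / 2 : ℂ) * limitZ (s / 2)

/-! ### Generalized hypergeometric functions -/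

/-- The coefficient `(a₁)ₙ ⋯ (aₚ)ₙ / ((b₁)ₙ ⋯ (b_q)ₙ n!)` of the generalized hypergeometric
series, with `(c)ₙ = c (c + 1) ⋯ (c + n - 1)`. -/
def hypCoeff (a b : List ℂ) (n : ℕ) : ℂ :=
  (a.map fun c => (ascPochhammer ℂ n).eval c).prod /
    ((b.map fun c => (ascPochhammer ℂ n).eval c).prod * (n ! : ℂ))

/-- `F` is, on `ℂ \ [1, ∞)`, the (unique) analytic continuation of the generalized hypergeometric
series with parameters `a; b`, which converges on the unit disc. -/
structure IsHypContinuation (a b : List ℂ) (F : ℂ → ℂ) : Prop where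
  differentiableOn : DifferentiableOn ℂ F {w : ℂ | ¬ (1 ≤ w.re ∧ w.im = 0)}
  hasSum : ∀ w : ℂ, ‖w‖ < 1 → HasSum (fun n : ℕ => hypCoeff a b n * w ^ n) (F w)

/-! ### The integrands of the explicit forms -/

/-- The density `√(cosh y coth y / (2 - sinh y))` on `(0, log (2 + √5))`. -/
def cosDensity (y : ℝ) : ℝ :=
  √(Real.cosh y * (Real.cosh y / Real.sinh y) / (2 - Real.sinh y))

/-- The Abelian integrand, with `a = 2 + √5`. -/
def abelianIntegrand (s : ℂ) (z : ℝ) : ℂ :=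
  ((z : ℂ) ^ 2 + 1) * (z : ℂ) ^ (-1 - s) * (1 + (z : ℂ) ^ (2 * s)) /
    (2 * (√((1 + z) * (1 - z) * (z - (2 + √5)) * (z + 1 / (2 + √5))) : ℝ))

end

/-!
The connection Laplacian of the cycle commutes with rotation, so the discrete Fourier transform on
`ZMod n`, applied to vertices and to edges, splits it into `2 × 2` blocks with determinant `-1` and
trace `y = 4 cos² (πk/n)` (`circularMatrix_mul_circularFourier`, `circularBlock_sq_charpoly`). The
eigenvalues of a block are `f₊(y) = exp u` and `f₋(y) = -exp (-u)` with `u = arsinh (y / 2)`, so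
the zeta function of the cycle is the sum of `2 cosh (2 s arsinh (2 cos² πx))` over the points
`x = k/n`, and division by `n` makes it a Riemann sum of `limitZ s` (`tendsto_circularZeta_div`).

The explicit integrals are changes of variables in
`limitZ s = ∫₀¹ 2 cosh (2 s arsinh (2 sin² πx)) dx` on the half period `0 < x < 1/2`: they use
`v = sin² πx`, then `y = arsinh (2 v)`, then `z = exp y`. The new integrands are unbounded at the
endpoints, but multiplied by the Jacobian they become continuous functions of `x`, which gives
integrability and the value together (`integral_eq_of_strictMonoOn`).

For the hypergeometric form, let `Φ (sin² θ) = cos (2 s θ)`. This defines a holomorphic function on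
the plane cut along `[1, ∞)` (`exists_differentiableOn_cos_arcsin_sqrt`): with `√w = sin θ`, the
number `tan² (θ/2) = (1 - √(1 - w)) / (1 + √(1 - w))` is holomorphic in `w` with values in the unit
disc, and `cos (4 s arctan t)` is even in `t`. Differentiating the defining relation twice gives a
hypergeometric differential equation, whose derivatives at `0` give the recursion for the Taylor
coefficients, so `Φ = ₂F₁(-s, s; 1/2; ·)` (`hasSum_hypergeometric_cos_arcsin`). The average
`F w = ∫₀¹ Φ (sin⁴(πx) w) dx` is holomorphic on the cut plane, and the moments of `sin⁴` supply the
parameters `1/4, 3/4; 1/2, 1` (`integral_sin_pow_four_mul`), so `F` continues the `₄F₃` series. At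
`w = -4` one has `sin² θ = -4 sin⁴ πx` for `θ = i arsinh (2 sin² πx)`, and the integrand is
`cosh (2 s arsinh (2 sin² πx))`. The identity theorem makes the value independent of the choice of
continuation.
-/

/-! ### The integrand as a hyperbolic cosine -/

/-- The two solutions of `x - 1 / x = y` are `exp u` and `-exp (-u)` with `u = arsinh (y / 2)`. -/
theorem fPlus_eq_exp (y : ℝ) : fPlus y = Real.exp (Real.arsinh (y / 2)) := by
  have h : √(1 + (y / 2) ^ 2) = √(y ^ 2 + 4) / 2 := by
    rw [show 1 + (y / 2) ^ 2 = (y ^ 2 + 4) / 2 ^ 2 by ring, Real.sqrt_div' _ (by norm_num),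
      Real.sqrt_sq (by norm_num)]
  rw [Real.exp_arsinh, h, fPlus]
  ring

theorem fMinus_eq_neg_exp (y : ℝ) : fMinus y = -Real.exp (-Real.arsinh (y / 2)) := by
  have h := fPlus_eq_exp (-y)
  rw [neg_div, Real.arsinh_neg] at h
  rw [← h, fPlus, fMinus, neg_sq]
  ring

theorem ofReal_exp_sq_cpow (u : ℝ) (s : ℂ) :
    ((Real.exp u ^ 2 : ℝ) : ℂ) ^ s = Complex.exp (2 * s * u) := by
  rw [← Real.exp_nat_mul, Complex.cpow_def_of_ne_zero (by exact_mod_cast (Real.exp_pos _).ne'),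
    ← Complex.ofReal_log (Real.exp_pos _).le, Real.log_exp]
  push_cast
  ring_nf

theorem fPlus_cpow_add_fMinus_cpow (y : ℝ) (s : ℂ) :
    ((fPlus y ^ 2 : ℝ) : ℂ) ^ s + ((fMinus y ^ 2 : ℝ) : ℂ) ^ s =
      2 * Complex.cosh (2 * s * (Real.arsinh (y / 2) : ℝ)) := by
  rw [fPlus_eq_exp, fMinus_eq_neg_exp, neg_sq, ofReal_exp_sq_cpow, ofReal_exp_sq_cpow,
    Complex.cosh]
  push_cast
  ring_nf

theorem limitZ_eq_integral_cosh (s : ℂ) :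
    limitZ s = ∫ x in (0 : ℝ)..1,
      2 * Complex.cosh (2 * s * (Real.arsinh (2 * Real.sin (Real.pi * x) ^ 2) : ℝ)) := by
  simp only [limitZ, fPlus_cpow_add_fMinus_cpow]
  congr 1 with x
  ring_nf

theorem continuous_cosh_arsinh_sin (s : ℂ) : Continuous fun x : ℝ =>
    Complex.cosh (2 * s * (Real.arsinh (2 * Real.sin (Real.pi * x) ^ 2) : ℝ)) := by
  have h : Continuous fun x : ℝ => Real.arsinh (2 * Real.sin (Real.pi * x) ^ 2) :=
    Real.continuous_arsinh.comp (by fun_prop)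
  exact Complex.continuous_cosh.comp (by fun_prop)

/-- By the symmetry `x ↦ 1 - x`, half of the period determines the integral. -/
theorem limitZ_eq_integral_half (s : ℂ) :
    limitZ s = ∫ x in (0 : ℝ)..(1 / 2),
      4 * Complex.cosh (2 * s * (Real.arsinh (2 * Real.sin (Real.pi * x) ^ 2) : ℝ)) := by
  set f : ℝ → ℂ := fun x =>
    Complex.cosh (2 * s * (Real.arsinh (2 * Real.sin (Real.pi * x) ^ 2) : ℝ)) with hf
  have hc : Continuous f := continuous_cosh_arsinh_sin s
  have hsymm : ∀ x, f (1 - x) = f x := fun x => by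
    simp only [hf]
    rw [mul_sub, mul_one, Real.sin_pi_sub]
  have hr : ∫ x in (1 / 2 : ℝ)..1, f x = ∫ x in (0 : ℝ)..(1 / 2), f x := by
    have h := intervalIntegral.integral_comp_sub_left (a := 0) (b := 1 / 2) f 1
    simp only [hsymm] at h
    rw [h]
    norm_num
  rw [limitZ_eq_integral_cosh, intervalIntegral.integral_const_mul,
    intervalIntegral.integral_const_mul,
    ← intervalIntegral.integral_add_adjacent_intervals (hc.intervalIntegrable 0 (1 / 2))
      (hc.intervalIntegrable (1 / 2) 1), hr]
  ring

/-! ### Change of variables with integrable endpoint singularities -/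

/-- If `p` maps `(a, b)` monotonically onto `(p a, p b)` and `|p'| g ∘ p` extends to a continuous
function, then `g` is integrable, whatever its singularities at the endpoints. -/
theorem integral_eq_of_strictMonoOn {p p' : ℝ → ℝ} {g k : ℝ → ℂ} {a b : ℝ} (hab : a ≤ b)
    (hp : ContinuousOn p (Set.Icc a b)) (hm : StrictMonoOn p (Set.Icc a b))
    (hd : ∀ x ∈ Set.Ioo a b, HasDerivAt p (p' x) x) (hk : Continuous k)
    (h : ∀ x ∈ Set.Ioo a b, (|p' x| : ℝ) * g (p x) = k x) :
    IntervalIntegrable g MeasureTheory.volume (p a) (p b) ∧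
      ∫ y in (p a)..(p b), g y = ∫ x in a..b, k x := by
  have hle : p a ≤ p b := hm.monotoneOn (Set.left_mem_Icc.2 hab) (Set.right_mem_Icc.2 hab) hab
  have himg := hp.image_Ioo_of_strictMonoOn hab hm
  have hinj : Set.InjOn p (Set.Ioo a b) := (hm.mono Set.Ioo_subset_Icc_self).injOn
  have hd' : ∀ x ∈ Set.Ioo a b, HasDerivWithinAt p (p' x) (Set.Ioo a b) x :=
    fun x hx => (hd x hx).hasDerivWithinAt
  have h' : Set.EqOn (fun x => |p' x| • g (p x)) k (Set.Ioo a b) := fun x hx => by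
    simp only [Complex.real_smul]
    exact h x hx
  constructor
  · rw [intervalIntegrable_iff_integrableOn_Ioo_of_le hle, ← himg,
      MeasureTheory.integrableOn_image_iff_integrableOn_abs_deriv_smul measurableSet_Ioo hd' hinj,
      MeasureTheory.integrableOn_congr_fun h' measurableSet_Ioo,
      ← intervalIntegrable_iff_integrableOn_Ioo_of_le hab]
    exact hk.intervalIntegrable a b
  · rw [intervalIntegral.integral_of_le hle, intervalIntegral.integral_of_le hab,
      MeasureTheory.integral_Ioc_eq_integral_Ioo, MeasureTheory.integral_Ioc_eq_integral_Ioo,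
      ← himg, MeasureTheory.integral_image_eq_integral_abs_deriv_smul measurableSet_Ioo hd' hinj]
    exact MeasureTheory.setIntegral_congr_fun measurableSet_Ioo h'

/-! ### The explicit integrals -/

theorem strictMonoOn_sin_pi_mul_sq :
    StrictMonoOn (fun x : ℝ => Real.sin (Real.pi * x) ^ 2) (Set.Icc 0 (1 / 2)) := by
  intro x hx y hy hxy
  have hpi := Real.pi_pos
  have h1 : Real.sin (Real.pi * x) < Real.sin (Real.pi * y) :=
    Real.sin_lt_sin_of_lt_of_le_pi_div_two (by nlinarith [hx.1]) (by nlinarith [hy.2])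
      (by nlinarith)
  have h0 : 0 ≤ Real.sin (Real.pi * x) :=
    Real.sin_nonneg_of_nonneg_of_le_pi (by nlinarith [hx.1]) (by nlinarith [hx.2])
  exact pow_lt_pow_left₀ h1 h0 two_ne_zero

theorem sin_pi_mul_pos_cos_pi_mul_pos {x : ℝ} (hx : x ∈ Set.Ioo (0 : ℝ) (1 / 2)) :
    0 < Real.sin (Real.pi * x) ∧ 0 < Real.cos (Real.pi * x) := by
  have hpi := Real.pi_pos
  exact ⟨Real.sin_pos_of_pos_of_lt_pi (by nlinarith [hx.1]) (by nlinarith [hx.2]),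
    Real.cos_pos_of_mem_Ioo ⟨by nlinarith [hx.1], by nlinarith [hx.2]⟩⟩

theorem hasDerivAt_sin_pi_mul_sq (x : ℝ) : HasDerivAt (fun x : ℝ => Real.sin (Real.pi * x) ^ 2)
    (2 * Real.pi * (Real.sin (Real.pi * x) * Real.cos (Real.pi * x))) x := by
  have h := (((hasDerivAt_id x).const_mul Real.pi).sin).pow 2
  refine h.congr_deriv ?_
  norm_num
  ring

theorem hasDerivAt_arsinh_sin_pi_mul_sq (x : ℝ) :
    HasDerivAt (fun x : ℝ => Real.arsinh (2 * Real.sin (Real.pi * x) ^ 2))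
      (4 * Real.pi * (Real.sin (Real.pi * x) * Real.cos (Real.pi * x)) /
        √(1 + (2 * Real.sin (Real.pi * x) ^ 2) ^ 2)) x := by
  have h := ((hasDerivAt_sin_pi_mul_sq x).const_mul 2).arsinh
  convert h using 1
  simp only [smul_eq_mul]
  ring

theorem arsinh_two : Real.arsinh 2 = Real.log (2 + √5) := by
  rw [Real.arsinh]
  norm_num

theorem log_sqrt_add_eq_arsinh (v : ℝ) :
    Real.log (√(4 * v ^ 2 + 1) + 2 * v) = Real.arsinh (2 * v) := by
  rw [Real.arsinh, add_comm]
  ring_nf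

theorem cosh_I_mul (t : ℂ) : Complex.cosh (Complex.I * t) = Complex.cos t := by
  rw [mul_comm, Complex.cosh_mul_I]

/-- The density in terms of `x`, where `sinh y = 2 sin² πx`. -/
theorem cosDensity_arsinh {x : ℝ} (hx : x ∈ Set.Ioo (0 : ℝ) (1 / 2)) :
    cosDensity (Real.arsinh (2 * Real.sin (Real.pi * x) ^ 2)) =
      √(1 + (2 * Real.sin (Real.pi * x) ^ 2) ^ 2) /
        (2 * (Real.sin (Real.pi * x) * Real.cos (Real.pi * x))) := by
  obtain ⟨hs, hc⟩ := sin_pi_mul_pos_cos_pi_mul_pos hx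
  rw [cosDensity, Real.cosh_arsinh, Real.sinh_arsinh]
  set S := Real.sin (Real.pi * x)
  set C := Real.cos (Real.pi * x)
  have h1 : S ^ 2 = 1 - C ^ 2 := by rw [← Real.sin_sq_add_cos_sq (Real.pi * x)]; ring
  have h2 : 2 - 2 * S ^ 2 = 2 * C ^ 2 := by rw [h1]; ring
  rw [h2]
  set R := √(1 + (2 * S ^ 2) ^ 2)
  have hR : 0 ≤ R := Real.sqrt_nonneg _
  rw [show R * (R / (2 * S ^ 2)) / (2 * C ^ 2) = (R / (2 * (S * C))) ^ 2 by field_simp]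
  exact Real.sqrt_sq (by positivity)

theorem contDiffOn_cosDensity :
    ContDiffOn ℝ ∞ cosDensity (Set.Ioo 0 (Real.log (2 + √5))) := by
  have hs : ∀ y ∈ Set.Ioo 0 (Real.log (2 + √5)), 0 < Real.sinh y ∧ 0 < 2 - Real.sinh y := by
    intro y hy
    refine ⟨Real.sinh_pos_iff.2 hy.1, ?_⟩
    have h := Real.sinh_lt_sinh.2 hy.2
    rw [← arsinh_two, Real.sinh_arsinh] at h
    linarith
  unfold cosDensity
  refine ContDiffOn.sqrt ?_ fun y hy => ?_
  · refine ContDiffOn.div (ContDiffOn.mul ?_ (ContDiffOn.div ?_ ?_ ?_)) ?_ ?_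
    · exact Real.contDiff_cosh.contDiffOn
    · exact Real.contDiff_cosh.contDiffOn
    · exact Real.contDiff_sinh.contDiffOn
    · exact fun y hy => (hs y hy).1.ne'
    · exact contDiffOn_const.sub Real.contDiff_sinh.contDiffOn
    · exact fun y hy => (hs y hy).2.ne'
  · have h1 := hs y hy
    have h2 := Real.cosh_pos y
    have := h1.1
    have := h1.2
    positivity

theorem limitZeta_eq_cosine_transform (t : ℂ) :
    IntervalIntegrable (fun y : ℝ => Complex.cos (t * (y : ℂ)) * (cosDensity y : ℂ))
        MeasureTheory.volume 0 (Real.log (2 + √5)) ∧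
      limitZeta (Complex.I * t) =
        ∫ y in (0 : ℝ)..Real.log (2 + √5), Complex.cos (t * (y : ℂ)) * (cosDensity y : ℂ) := by
  have key := integral_eq_of_strictMonoOn
    (p := fun x : ℝ => Real.arsinh (2 * Real.sin (Real.pi * x) ^ 2))
    (g := fun y : ℝ => Complex.cos (t * (y : ℂ)) * (cosDensity y : ℂ))
    (k := fun x : ℝ => 2 * Real.pi *
      Complex.cosh (2 * (Complex.I * t / 2) * (Real.arsinh (2 * Real.sin (Real.pi * x) ^ 2) : ℝ)))
    (a := 0) (b := 1 / 2) (by norm_num)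
    (Real.continuous_arsinh.comp (by fun_prop)).continuousOn
    (fun x hx y hy h => Real.arsinh_strictMono
      (mul_lt_mul_of_pos_left (strictMonoOn_sin_pi_mul_sq hx hy h) two_pos))
    (fun x _ => hasDerivAt_arsinh_sin_pi_mul_sq x)
    (continuous_const.mul (continuous_cosh_arsinh_sin _)) ?_
  · simp only [mul_zero, Real.sin_zero, ne_eq, OfNat.ofNat_ne_zero, not_false_eq_true, zero_pow,
      Real.arsinh_zero, mul_one_div, Real.sin_pi_div_two, one_pow, mul_one, arsinh_two] at key
    refine ⟨key.1, ?_⟩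
    rw [key.2, limitZeta, limitZ_eq_integral_half, intervalIntegral.integral_const_mul,
      intervalIntegral.integral_const_mul]
    ring
  · intro x hx
    obtain ⟨hs, hc⟩ := sin_pi_mul_pos_cos_pi_mul_pos hx
    have hR : 0 < √(1 + (2 * Real.sin (Real.pi * x) ^ 2) ^ 2) := by positivity
    rw [cosDensity_arsinh hx, abs_of_pos (by positivity), mul_left_comm, ← Complex.ofReal_mul,
      show 2 * (Complex.I * t / 2) = Complex.I * t by ring, mul_assoc Complex.I, cosh_I_mul,
      mul_comm]
    congr 1
    rw [show (2 : ℂ) * Real.pi = ((2 * Real.pi : ℝ) : ℂ) by push_cast; rfl]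
    congr 1
    field_simp
    norm_num

theorem limitZ_eq_integral_cos_log (t : ℂ) :
    IntervalIntegrable (fun x : ℝ => 2 * Complex.cos (t * (Real.log
        ((√(4 * Real.sin (Real.pi * x) ^ 4 + 1) + 2 * Real.sin (Real.pi * x) ^ 2) ^ 2) : ℝ)))
      MeasureTheory.volume 0 1 ∧
    limitZ (Complex.I * t) =
      ∫ x in (0 : ℝ)..1, 2 * Complex.cos (t * (Real.log
        ((√(4 * Real.sin (Real.pi * x) ^ 4 + 1) + 2 * Real.sin (Real.pi * x) ^ 2) ^ 2) : ℝ)) := by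
  have h : (fun x : ℝ => 2 * Complex.cos (t * (Real.log
      ((√(4 * Real.sin (Real.pi * x) ^ 4 + 1) + 2 * Real.sin (Real.pi * x) ^ 2) ^ 2) : ℝ))) =
      fun x : ℝ => 2 * Complex.cosh
        (2 * (Complex.I * t) * (Real.arsinh (2 * Real.sin (Real.pi * x) ^ 2) : ℝ)) := by
    ext x
    rw [Real.log_pow, show Real.sin (Real.pi * x) ^ 4 = (Real.sin (Real.pi * x) ^ 2) ^ 2 by ring,
      log_sqrt_add_eq_arsinh, show ∀ u : ℂ, 2 * (Complex.I * t) * u = Complex.I * (t * (2 * u)) by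
        intro u; ring, cosh_I_mul]
    push_cast
    rfl
  rw [h]
  exact ⟨(continuous_const.mul (continuous_cosh_arsinh_sin _)).intervalIntegrable _ _,
    limitZ_eq_integral_cosh _⟩

theorem limitZ_eq_integral_arcsine_density (t : ℂ) :
    IntervalIntegrable (fun v : ℝ =>
        2 * Complex.cos (2 * t * (Real.log (√(4 * v ^ 2 + 1) + 2 * v) : ℝ)) /
          ((Real.pi * √(1 - v) * √v : ℝ) : ℂ))
      MeasureTheory.volume 0 1 ∧
    limitZ (Complex.I * t) =
      ∫ v in (0 : ℝ)..1,
        2 * Complex.cos (2 * t * (Real.log (√(4 * v ^ 2 + 1) + 2 * v) : ℝ)) /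
          ((Real.pi * √(1 - v) * √v : ℝ) : ℂ) := by
  have key := integral_eq_of_strictMonoOn
    (p := fun x : ℝ => Real.sin (Real.pi * x) ^ 2)
    (g := fun v : ℝ => 2 * Complex.cos (2 * t * (Real.log (√(4 * v ^ 2 + 1) + 2 * v) : ℝ)) /
          ((Real.pi * √(1 - v) * √v : ℝ) : ℂ))
    (k := fun x : ℝ => 4 *
      Complex.cosh (2 * (Complex.I * t) * (Real.arsinh (2 * Real.sin (Real.pi * x) ^ 2) : ℝ)))
    (a := 0) (b := 1 / 2) (by norm_num) (by fun_prop) strictMonoOn_sin_pi_mul_sq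
    (fun x _ => hasDerivAt_sin_pi_mul_sq x)
    (continuous_const.mul (continuous_cosh_arsinh_sin _)) ?_
  · simp only [mul_zero, Real.sin_zero, ne_eq, OfNat.ofNat_ne_zero, not_false_eq_true, zero_pow,
      mul_one_div, Real.sin_pi_div_two, one_pow] at key
    exact ⟨key.1, by rw [key.2, limitZ_eq_integral_half]⟩
  · intro x hx
    obtain ⟨hs, hc⟩ := sin_pi_mul_pos_cos_pi_mul_pos hx
    have hpi := Real.pi_pos
    rw [log_sqrt_add_eq_arsinh, abs_of_pos (by positivity), Real.sqrt_sq hs.le,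
      ← Real.cos_sq', Real.sqrt_sq hc.le, show ∀ u : ℂ, 2 * (Complex.I * t) * u =
        Complex.I * (2 * t * u) by intro u; ring, cosh_I_mul]
    have hs' : (Real.sin (Real.pi * x) : ℂ) ≠ 0 := by exact_mod_cast hs.ne'
    have hc' : (Real.cos (Real.pi * x) : ℂ) ≠ 0 := by exact_mod_cast hc.ne'
    have hp' : (Real.pi : ℂ) ≠ 0 := by exact_mod_cast hpi.ne'
    rw [Complex.ofReal_mul, Complex.ofReal_mul, Complex.ofReal_mul, Complex.ofReal_mul,
      Complex.ofReal_mul]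
    push_cast at hs' hc' ⊢
    field_simp
    ring

/-- With `z = exp y`, the Abelian integrand `abelianIntegrand s z dz` becomes
`cosh (s y) cosDensity y dy`. -/
theorem abelianIntegrand_exp {x : ℝ} (hx : x ∈ Set.Ioo (0 : ℝ) (1 / 2)) (s : ℂ) :
    abelianIntegrand s (Real.exp (Real.arsinh (2 * Real.sin (Real.pi * x) ^ 2))) =
      Complex.cosh (s * (Real.arsinh (2 * Real.sin (Real.pi * x) ^ 2) : ℝ)) *
        (cosDensity (Real.arsinh (2 * Real.sin (Real.pi * x) ^ 2)) : ℝ) *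
        (Real.exp (-Real.arsinh (2 * Real.sin (Real.pi * x) ^ 2)) : ℝ) := by
  obtain ⟨hs, hc⟩ := sin_pi_mul_pos_cos_pi_mul_pos hx
  rw [cosDensity_arsinh hx, ← Real.cosh_arsinh]
  set u := Real.arsinh (2 * Real.sin (Real.pi * x) ^ 2) with hu
  have hsinh : Real.sinh u = 2 * Real.sin (Real.pi * x) ^ 2 := Real.sinh_arsinh _
  set S := Real.sin (Real.pi * x)
  set C := Real.cos (Real.pi * x)
  have h1 : C ^ 2 = 1 - S ^ 2 := by rw [← Real.sin_sq_add_cos_sq (Real.pi * x)]; ring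
  have hz : 0 < Real.exp u := Real.exp_pos u
  -- `2 sinh u = z - 1 / z` turns the quartic under the root into `16 z² S² C²`
  have hz2 : Real.exp u ^ 2 = 1 + 4 * S ^ 2 * Real.exp u := by
    have h := hsinh
    rw [Real.sinh_eq, Real.exp_neg] at h
    field_simp at h
    linarith
  have hsqrt : √((1 + Real.exp u) * (1 - Real.exp u) * (Real.exp u - (2 + √5)) *
      (Real.exp u + 1 / (2 + √5))) = 4 * Real.exp u * (S * C) := by
    have h5 : √5 ^ 2 = 5 := Real.sq_sqrt (by norm_num)
    have ha : 1 / (2 + √5) = √5 - 2 := by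
      rw [div_eq_iff (by positivity)]
      linarith
    have he : (1 + Real.exp u) * (1 - Real.exp u) * (Real.exp u - (2 + √5)) *
        (Real.exp u + 1 / (2 + √5)) = (4 * Real.exp u * (S * C)) ^ 2 := by
      rw [ha]
      calc _ = (1 - Real.exp u ^ 2) * (Real.exp u ^ 2 - 4 * Real.exp u + 4 - √5 ^ 2) := by ring
        _ = (4 * Real.exp u) ^ 2 * (S ^ 2 * (1 - S ^ 2)) := by rw [h5, hz2]; ring
        _ = _ := by rw [← h1]; ring
    rw [he, Real.sqrt_sq (by positivity)]
  have hz0 : ((Real.exp u : ℝ) : ℂ) ≠ 0 := by exact_mod_cast hz.ne'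
  have hlog : Complex.log ((Real.exp u : ℝ) : ℂ) = u := by
    rw [← Complex.ofReal_log hz.le, Real.log_exp]
  have hs' : (S : ℂ) ≠ 0 := by exact_mod_cast hs.ne'
  have hc' : (C : ℂ) ≠ 0 := by exact_mod_cast hc.ne'
  rw [abelianIntegrand, hsqrt, Complex.cpow_def_of_ne_zero hz0, Complex.cpow_def_of_ne_zero hz0,
    hlog, Complex.cosh, Real.cosh_eq]
  push_cast
  have e1 : Complex.exp (u * (-1 - s)) = Complex.exp (-u) * Complex.exp (-(s * u)) := by
    rw [← Complex.exp_add]; ring_nf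
  have e2 : Complex.exp (u * (2 * s)) = Complex.exp (s * u) * Complex.exp (s * u) := by
    rw [← Complex.exp_add]; ring_nf
  rw [e1, e2, Complex.exp_neg, Complex.exp_neg]
  have n1 := Complex.exp_ne_zero (u : ℂ)
  have n2 := Complex.exp_ne_zero (s * u)
  field_simp
  ring

theorem limitZeta_eq_abelian_integral (s : ℂ) :
    IntervalIntegrable (abelianIntegrand s) MeasureTheory.volume 1 (2 + √5) ∧
      limitZeta s = ∫ z in (1 : ℝ)..(2 + √5), abelianIntegrand s z := by
  have key := integral_eq_of_strictMonoOn
    (p := fun x : ℝ => Real.exp (Real.arsinh (2 * Real.sin (Real.pi * x) ^ 2)))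
    (g := abelianIntegrand s)
    (k := fun x : ℝ => 2 * Real.pi *
      Complex.cosh (2 * (s / 2) * (Real.arsinh (2 * Real.sin (Real.pi * x) ^ 2) : ℝ)))
    (a := 0) (b := 1 / 2) (by norm_num)
    (Real.continuous_exp.comp (Real.continuous_arsinh.comp (by fun_prop))).continuousOn
    (fun x hx y hy h => Real.exp_strictMono (Real.arsinh_strictMono
      (mul_lt_mul_of_pos_left (strictMonoOn_sin_pi_mul_sq hx hy h) two_pos)))
    (fun x _ => (hasDerivAt_arsinh_sin_pi_mul_sq x).exp)
    (continuous_const.mul (continuous_cosh_arsinh_sin _)) ?_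
  · simp only [mul_zero, Real.sin_zero, ne_eq, OfNat.ofNat_ne_zero, not_false_eq_true, zero_pow,
      Real.arsinh_zero, mul_one_div, Real.sin_pi_div_two, one_pow, mul_one, arsinh_two,
      Real.exp_zero] at key
    rw [Real.exp_log (by positivity)] at key
    refine ⟨key.1, ?_⟩
    rw [key.2, limitZeta, limitZ_eq_integral_half, intervalIntegral.integral_const_mul,
      intervalIntegral.integral_const_mul]
    ring
  · intro x hx
    obtain ⟨hs, hc⟩ := sin_pi_mul_pos_cos_pi_mul_pos hx
    have hR : 0 < √(1 + (2 * Real.sin (Real.pi * x) ^ 2) ^ 2) := by positivity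
    rw [abelianIntegrand_exp hx, cosDensity_arsinh hx, abs_of_pos (by positivity), Real.exp_neg,
      show 2 * (s / 2) = s by ring, mul_assoc (Complex.cosh _), mul_left_comm,
      ← Complex.ofReal_mul, ← Complex.ofReal_mul, mul_comm,
      show (2 : ℂ) * Real.pi = ((2 * Real.pi : ℝ) : ℂ) by push_cast; rfl]
    congr 2
    have hz := Real.exp_pos (Real.arsinh (2 * Real.sin (Real.pi * x) ^ 2))
    field_simp
    norm_num

/-! ### The function `cos (2 s arcsin √w)` on the slit plane -/

/-- An even holomorphic function on the unit disc is a holomorphic function of the square. -/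
theorem exists_differentiableOn_comp_sq {q : ℂ → ℂ} (hq : DifferentiableOn ℂ q (Metric.ball 0 1))
    (he : ∀ t, q (-t) = q t) :
    ∃ h : ℂ → ℂ, DifferentiableOn ℂ h (Metric.ball 0 1) ∧
      ∀ t ∈ Metric.ball (0 : ℂ) 1, h (t ^ 2) = q t := by
  have hroot : ∀ u : ℂ, (u ^ (((2 : ℕ) : ℂ)⁻¹)) ^ 2 = u := fun u =>
    Complex.cpow_nat_inv_pow u two_ne_zero
  have heq : ∀ a b : ℂ, a ^ 2 = b ^ 2 → q a = q b := by
    intro a b hab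
    rcases sq_eq_sq_iff_eq_or_eq_neg.1 hab with h | h
    · rw [h]
    · rw [h, he]
  have hball : ∀ a : ℂ, a ^ 2 ∈ Metric.ball (0 : ℂ) 1 → a ∈ Metric.ball (0 : ℂ) 1 := by
    intro a ha
    rw [mem_ball_zero_iff] at ha ⊢
    rw [norm_pow] at ha
    exact (pow_lt_one_iff_of_nonneg (norm_nonneg a) two_ne_zero).1 ha
  have hqd : ∀ a ∈ Metric.ball (0 : ℂ) 1, DifferentiableAt ℂ q a := fun a ha =>
    hq.differentiableAt (Metric.isOpen_ball.mem_nhds ha)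
  refine ⟨fun u => q (u ^ (((2 : ℕ) : ℂ)⁻¹)), ?_, fun t _ => heq _ _ (hroot _)⟩
  rw [← Complex.differentiableOn_compl_singleton_and_continuousAt_iff
    (c := 0) (Metric.ball_mem_nhds 0 one_pos)]
  constructor
  · rintro u ⟨hu, hu0⟩
    rw [Set.mem_singleton_iff] at hu0
    apply DifferentiableAt.differentiableWithinAt
    by_cases hs : u ∈ Complex.slitPlane
    · exact (hqd _ (hball _ (by rwa [hroot]))).comp u
        ((differentiableAt_id).cpow_const hs)
    · -- on the cut, `I * √(-u)` is a holomorphic branch of the root; evenness makes `q` agree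
      have hs' : -u ∈ Complex.slitPlane := by
        rw [Complex.mem_slitPlane_iff] at hs ⊢
        push Not at hs
        left
        have : u.re ≠ 0 := fun h => hu0 (Complex.ext h hs.2)
        have := lt_of_le_of_ne hs.1 this
        rw [Complex.neg_re]
        linarith
      have hsq : ∀ v : ℂ, (Complex.I * (-v) ^ (((2 : ℕ) : ℂ)⁻¹)) ^ 2 = v := by
        intro v
        rw [mul_pow, Complex.I_sq, hroot]
        ring
      have hfun : (fun v : ℂ => q (v ^ (((2 : ℕ) : ℂ)⁻¹))) =
          fun v => q (Complex.I * (-v) ^ (((2 : ℕ) : ℂ)⁻¹)) :=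
        funext fun v => heq _ _ (by rw [hroot, hsq])
      rw [hfun]
      have hd : DifferentiableAt ℂ (fun v : ℂ => Complex.I * (-v) ^ (((2 : ℕ) : ℂ)⁻¹)) u :=
        (differentiableAt_id.neg.cpow_const hs').const_mul _
      exact (hqd _ (hball _ (by rwa [hsq]))).comp u hd
  · have h0 : ContinuousAt (fun u : ℂ => u ^ (((2 : ℕ) : ℂ)⁻¹)) 0 :=
      Complex.continuousAt_cpow_zero_of_re_pos (z := ((2 : ℕ) : ℂ)⁻¹) (by norm_num) |>.comp
        (f := fun u : ℂ => (u, ((2 : ℕ) : ℂ)⁻¹)) (x := 0) (by fun_prop)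
    refine ContinuousAt.comp (g := q) ?_ h0
    exact (hqd _ (hball _ (by rw [hroot]; exact Metric.mem_ball_self one_pos))).continuousAt

/-- The plane cut along `[1, ∞)`. -/
def slitDomain : Set ℂ := {w : ℂ | ¬ (1 ≤ w.re ∧ w.im = 0)}

theorem mem_slitDomain_iff {w : ℂ} : w ∈ slitDomain ↔ 1 - w ∈ Complex.slitPlane := by
  rw [slitDomain, Set.mem_ofPred_eq, Complex.mem_slitPlane_iff, not_and_or, not_le]
  simp

theorem isOpen_slitDomain : IsOpen slitDomain := by
  have h : slitDomain = (fun w : ℂ => 1 - w) ⁻¹' Complex.slitPlane :=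
    Set.ext fun _ => mem_slitDomain_iff
  rw [h]
  exact Complex.isOpen_slitPlane.preimage (by fun_prop)

theorem ofReal_mul_mem_slitDomain {w : ℂ} (hw : w ∈ slitDomain) {t : ℝ} (h0 : 0 ≤ t)
    (h1 : t ≤ 1) : (t : ℂ) * w ∈ slitDomain := by
  rintro ⟨hre, him⟩
  rw [Complex.re_ofReal_mul] at hre
  rw [Complex.im_ofReal_mul] at him
  have ht : t ≠ 0 := by
    rintro rfl
    norm_num at hre
  have htp : 0 < t := lt_of_le_of_ne h0 ht.symm
  refine hw ⟨?_, (mul_eq_zero.1 him).resolve_left ht⟩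
  by_contra h
  push Not at h
  nlinarith

theorem ball_subset_slitDomain : Metric.ball (0 : ℂ) 1 ⊆ slitDomain := by
  rintro w hw ⟨hre, -⟩
  rw [mem_ball_zero_iff] at hw
  linarith [Complex.re_le_norm w]

theorem isPreconnected_slitDomain : IsPreconnected slitDomain := by
  have h : StarConvex ℝ 0 slitDomain := by
    rw [starConvex_zero_iff]
    intro w hw t h0 h1
    rw [Complex.real_smul]
    exact ofReal_mul_mem_slitDomain hw h0 h1
  exact (h.isPathConnected (ball_subset_slitDomain (Metric.mem_ball_self one_pos))).isConnected.isPreconnected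

theorem re_cos_pos {θ : ℂ} (hθ : |θ.re| < Real.pi / 2) : 0 < (Complex.cos θ).re := by
  rw [Complex.cos_eq]
  have h : (Complex.cos θ.re * Complex.cosh θ.im - Complex.sin θ.re * Complex.sinh θ.im *
      Complex.I).re = Real.cos θ.re * Real.cosh θ.im := by
    rw [← Complex.ofReal_cos, ← Complex.ofReal_sin, ← Complex.ofReal_cosh, ← Complex.ofReal_sinh,
      ← Complex.ofReal_mul, ← Complex.ofReal_mul]
    simp only [Complex.sub_re, Complex.ofReal_re, Complex.re_ofReal_mul, Complex.I_re, mul_zero,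
      sub_zero]
  rw [h]
  exact mul_pos (Real.cos_pos_of_mem_Ioo (abs_lt.1 hθ)) (Real.cosh_pos _)

theorem sin_sq_mem_slitDomain {θ : ℂ} (hθ : |θ.re| < Real.pi / 2) :
    Complex.sin θ ^ 2 ∈ slitDomain := by
  have h := re_cos_pos hθ
  rw [mem_slitDomain_iff, ← Complex.cos_sq', Complex.mem_slitPlane_iff]
  by_contra hc
  push Not at hc
  rw [sq, Complex.mul_re, Complex.mul_im] at hc
  have him : (Complex.cos θ).im = 0 := by
    have : (Complex.cos θ).re * (Complex.cos θ).im = 0 := by linarith [hc.2]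
    exact (mul_eq_zero.1 this).resolve_left h.ne'
  have := hc.1
  rw [him] at this
  nlinarith

/-- The function `w ↦ cos (2 s arcsin √w)` is holomorphic on the plane cut along `[1, ∞)`. With
`r = √(1 - w)` and `u = (1 - r) / (1 + r)`, it equals `cos (4 s arctan √u)`, where `u` lies in the
unit disc and the cosine is an even function of `√u`. -/
theorem exists_differentiableOn_cos_arcsin_sqrt (s : ℂ) :
    ∃ Φ : ℂ → ℂ, DifferentiableOn ℂ Φ slitDomain ∧
      ∀ θ : ℂ, |θ.re| < Real.pi / 2 → Φ (Complex.sin θ ^ 2) = Complex.cos (2 * s * θ) := by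
  obtain ⟨h, hh, hsq⟩ := exists_differentiableOn_comp_sq (q := fun t : ℂ => Complex.cosh
      (2 * s * (Complex.log (1 + t * Complex.I) - Complex.log (1 - t * Complex.I)))) (by
    intro t ht
    rw [mem_ball_zero_iff] at ht
    have h1 : 1 + t * Complex.I ∈ Complex.slitPlane :=
      Complex.mem_slitPlane_of_norm_lt_one (by simpa using ht)
    have h2 : 1 - t * Complex.I ∈ Complex.slitPlane := by
      rw [sub_eq_add_neg]
      exact Complex.mem_slitPlane_of_norm_lt_one (by simpa using ht)
    apply DifferentiableAt.differentiableWithinAt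
    refine DifferentiableAt.ccosh (DifferentiableAt.const_mul (DifferentiableAt.sub ?_ ?_) _)
    · exact DifferentiableAt.clog (by fun_prop) h1
    · exact DifferentiableAt.clog (by fun_prop) h2) (by
    intro t
    simp only [neg_mul, sub_neg_eq_add, ← sub_eq_add_neg]
    rw [← Complex.cosh_neg]
    congr 1
    ring)
  -- the principal root of `1 - w`, which has positive real part off the cut
  set r : ℂ → ℂ := fun w => Complex.exp (Complex.log (1 - w) / 2) with hr
  have hr2 : ∀ w, 1 - w ≠ 0 → r w ^ 2 = 1 - w := by
    intro w hw
    rw [hr, ← Complex.exp_nat_mul]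
    push_cast
    rw [mul_div_cancel₀ _ two_ne_zero, Complex.exp_log hw]
  have hrre : ∀ w ∈ slitDomain, 0 < (r w).re := by
    intro w hw
    have harg := Complex.mem_slitPlane_iff_arg.1 (mem_slitDomain_iff.1 hw)
    have him : (Complex.log (1 - w) / 2).im = Complex.arg (1 - w) / 2 := by
      rw [← Complex.log_im]
      simp
    rw [hr, Complex.exp_re, him]
    have h1 := Complex.neg_pi_lt_arg (1 - w)
    have h2 := lt_of_le_of_ne (Complex.arg_le_pi (1 - w)) harg.1
    exact mul_pos (Real.exp_pos _) (Real.cos_pos_of_mem_Ioo ⟨by linarith, by linarith⟩)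
  have hne : ∀ z : ℂ, 0 < z.re → 1 + z ≠ 0 := by
    intro z hz h0
    have := congrArg Complex.re h0
    simp at this
    linarith
  have hlt : ∀ z : ℂ, 0 < z.re → (1 - z) / (1 + z) ∈ Metric.ball (0 : ℂ) 1 := by
    intro z hz
    rw [mem_ball_zero_iff, norm_div, div_lt_one (norm_pos_iff.2 (hne z hz)),
      ← sq_lt_sq₀ (norm_nonneg _) (norm_nonneg _), ← Complex.normSq_eq_norm_sq,
      ← Complex.normSq_eq_norm_sq, Complex.normSq_apply, Complex.normSq_apply]
    simp
    nlinarith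
  refine ⟨fun w => h ((1 - r w) / (1 + r w)), ?_, ?_⟩
  · intro w hw
    have hrd : DifferentiableAt ℂ r w := by
      refine DifferentiableAt.cexp (DifferentiableAt.div_const ?_ 2)
      exact DifferentiableAt.clog (by fun_prop) (mem_slitDomain_iff.1 hw)
    have hud : DifferentiableAt ℂ (fun w => (1 - r w) / (1 + r w)) w :=
      (hrd.const_sub 1).div (hrd.const_add 1) (hne _ (hrre w hw))
    exact ((hh.differentiableAt (Metric.isOpen_ball.mem_nhds (hlt _ (hrre w hw)))).comp w
      hud).differentiableWithinAt
  · intro θ hθ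
    have hc := re_cos_pos hθ
    have hmem := sin_sq_mem_slitDomain hθ
    have hrc : r (Complex.sin θ ^ 2) = Complex.cos θ := by
      have h2 := hr2 (Complex.sin θ ^ 2) (Complex.slitPlane_ne_zero (mem_slitDomain_iff.1 hmem))
      rw [← Complex.cos_sq'] at h2
      rcases sq_eq_sq_iff_eq_or_eq_neg.1 h2 with h | h
      · exact h
      · have := hrre _ hmem
        rw [h, Complex.neg_re] at this
        linarith
    have hθ2 : |(θ / 2).re| < Real.pi / 2 := by
      have h2 : (θ / 2).re = θ.re / 2 := by simp
      rw [h2, abs_div, abs_two]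
      linarith [abs_nonneg θ.re]
    have hc2 : Complex.cos (θ / 2) ≠ 0 := by
      intro h0
      have := re_cos_pos hθ2
      rw [h0] at this
      simp at this
    have htan : (1 - Complex.cos θ) / (1 + Complex.cos θ) = Complex.tan (θ / 2) ^ 2 := by
      have hcos : Complex.cos θ = 2 * Complex.cos (θ / 2) ^ 2 - 1 := by
        rw [← Complex.cos_two_mul]
        ring_nf
      rw [Complex.tan_eq_sin_div_cos, div_pow, Complex.sin_sq, hcos]
      field_simp
      ring
    have htb : Complex.tan (θ / 2) ∈ Metric.ball (0 : ℂ) 1 := by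
      have := hlt _ hc
      rw [htan, mem_ball_zero_iff, norm_pow] at this
      rw [mem_ball_zero_iff]
      exact (pow_lt_one_iff_of_nonneg (norm_nonneg _) two_ne_zero).1 this
    have hat : Complex.arctan (Complex.tan (θ / 2)) = θ / 2 := by
      refine Complex.arctan_tan ?_ (abs_lt.1 hθ2).1 (abs_lt.1 hθ2).2.le
      intro h0
      rw [h0] at hc2
      exact hc2 (by rw [Complex.cos_pi_div_two])
    beta_reduce
    rw [hrc, htan, hsq _ htb]
    rw [Complex.arctan, ← Complex.hasSum_arctan_aux (mem_ball_zero_iff.1 htb),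
      ← sub_eq_add_neg] at hat
    generalize Complex.log (1 + Complex.tan (θ / 2) * Complex.I) -
      Complex.log (1 - Complex.tan (θ / 2) * Complex.I) = l at hat ⊢
    have hl : l = θ * Complex.I := by
      linear_combination (2 * Complex.I) * hat + l * Complex.I_sq
    rw [hl, ← mul_assoc, Complex.cosh_mul_I]

/-! ### Taylor coefficients from the hypergeometric differential equation -/

/-- Differentiating `Φ (sin² θ) = cos (2 s θ)` twice gives the hypergeometric differential equation
at the points `w = sin² θ`. -/
theorem hypergeometric_ode_sin_sq {s : ℂ} {Φ : ℂ → ℂ} (hd : DifferentiableOn ℂ Φ slitDomain)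
    (hΦ : ∀ θ : ℂ, |θ.re| < Real.pi / 2 → Φ (Complex.sin θ ^ 2) = Complex.cos (2 * s * θ))
    {θ : ℂ} (hθ : |θ.re| < Real.pi / 2) :
    4 * Complex.sin θ ^ 2 * (1 - Complex.sin θ ^ 2) * deriv (deriv Φ) (Complex.sin θ ^ 2) +
      2 * (1 - 2 * Complex.sin θ ^ 2) * deriv Φ (Complex.sin θ ^ 2) +
      4 * s ^ 2 * Φ (Complex.sin θ ^ 2) = 0 := by
  have hU : IsOpen {θ : ℂ | |θ.re| < Real.pi / 2} :=
    isOpen_lt (Complex.continuous_re.abs) continuous_const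
  have hd1 : DifferentiableOn ℂ (deriv Φ) slitDomain := hd.deriv isOpen_slitDomain
  have hat : ∀ {f : ℂ → ℂ}, DifferentiableOn ℂ f slitDomain → ∀ τ : ℂ, |τ.re| < Real.pi / 2 →
      HasDerivAt (fun τ => f (Complex.sin τ ^ 2)) (deriv f (Complex.sin τ ^ 2) *
        (2 * Complex.sin τ * Complex.cos τ)) τ := by
    intro f hf τ hτ
    have h1 : HasDerivAt (fun τ => Complex.sin τ ^ 2) (2 * Complex.sin τ * Complex.cos τ) τ := by
      refine ((Complex.hasDerivAt_sin τ).pow 2).congr_deriv ?_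
      norm_num
    exact HasDerivAt.comp τ (hf.differentiableAt
      (isOpen_slitDomain.mem_nhds (sin_sq_mem_slitDomain hτ))).hasDerivAt h1
  have hlin : ∀ τ : ℂ, HasDerivAt (fun τ : ℂ => 2 * s * τ) (2 * s) τ := fun τ => by
    simpa using (hasDerivAt_id τ).const_mul (2 * s)
  have e1 : ∀ τ : ℂ, |τ.re| < Real.pi / 2 →
      deriv Φ (Complex.sin τ ^ 2) * (2 * Complex.sin τ * Complex.cos τ) =
        -Complex.sin (2 * s * τ) * (2 * s) := by
    intro τ hτ
    have h2 : HasDerivAt (fun τ : ℂ => Complex.cos (2 * s * τ))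
        (-Complex.sin (2 * s * τ) * (2 * s)) τ := (hlin τ).ccos
    refine (hat hd τ hτ).unique (h2.congr_of_eventuallyEq ?_)
    filter_upwards [hU.mem_nhds hτ] with x hx using hΦ x hx
  have h2 : HasDerivAt (fun τ : ℂ => -Complex.sin (2 * s * τ) * (2 * s))
      (-(Complex.cos (2 * s * θ) * (2 * s)) * (2 * s)) θ :=
    (hlin θ).csin.neg.mul_const _
  have h3 : HasDerivAt (fun τ : ℂ => 2 * Complex.sin τ * Complex.cos τ)
      (2 * Complex.cos θ * Complex.cos θ + 2 * Complex.sin θ * -Complex.sin θ) θ :=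
    ((Complex.hasDerivAt_sin θ).const_mul 2).mul (Complex.hasDerivAt_cos θ)
  have e2 := ((hat hd1 θ hθ).mul h3).unique (h2.congr_of_eventuallyEq (by
    filter_upwards [hU.mem_nhds hθ] with x hx using e1 x hx))
  rw [hΦ θ hθ]
  have hc := Complex.cos_sq' θ
  linear_combination e2 - (4 * Complex.sin θ ^ 2 * deriv (deriv Φ) (Complex.sin θ ^ 2) +
    2 * deriv Φ (Complex.sin θ ^ 2)) * hc

/-- The differential equation at the points `sin² x`, `x > 0`, which accumulate at `0`, extends by the
identity theorem. -/
theorem hypergeometric_ode {s : ℂ} {Φ : ℂ → ℂ} (hd : DifferentiableOn ℂ Φ slitDomain)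
    (hΦ : ∀ θ : ℂ, |θ.re| < Real.pi / 2 → Φ (Complex.sin θ ^ 2) = Complex.cos (2 * s * θ))
    {w : ℂ} (hw : w ∈ slitDomain) :
    4 * w * (1 - w) * deriv (deriv Φ) w + 2 * (1 - 2 * w) * deriv Φ w + 4 * s ^ 2 * Φ w = 0 := by
  have hd1 : DifferentiableOn ℂ (deriv Φ) slitDomain := hd.deriv isOpen_slitDomain
  have hd2 : DifferentiableOn ℂ (deriv (deriv Φ)) slitDomain := hd1.deriv isOpen_slitDomain
  have hR : DifferentiableOn ℂ (fun w => 4 * w * (1 - w) * deriv (deriv Φ) w +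
      2 * (1 - 2 * w) * deriv Φ w + 4 * s ^ 2 * Φ w) slitDomain := by
    refine ((DifferentiableOn.mul ?_ hd2).add (DifferentiableOn.mul ?_ hd1)).add
      (hd.const_mul _)
    · fun_prop
    · fun_prop
  have h0 : (0 : ℂ) ∈ slitDomain := ball_subset_slitDomain (Metric.mem_ball_self one_pos)
  refine (hR.analyticOnNhd isOpen_slitDomain).eqOn_zero_of_preconnected_of_frequently_eq_zero
    isPreconnected_slitDomain h0 ?_ hw
  have ht : Tendsto (fun x : ℝ => Complex.sin (x : ℂ) ^ 2) (𝓝[>] 0) (𝓝[≠] 0) := by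
    rw [tendsto_nhdsWithin_iff]
    constructor
    · have hc : Continuous fun x : ℝ => Complex.sin (x : ℂ) ^ 2 :=
        (Complex.continuous_sin.comp Complex.continuous_ofReal).pow 2
      have := hc.tendsto 0
      simp only [Complex.ofReal_zero, Complex.sin_zero, ne_eq, OfNat.ofNat_ne_zero,
        not_false_eq_true, zero_pow] at this
      exact this.mono_left nhdsWithin_le_nhds
    · filter_upwards [Ioo_mem_nhdsGT Real.pi_pos] with x hx
      have := Real.sin_pos_of_pos_of_lt_pi hx.1 hx.2
      rw [← Complex.ofReal_sin]
      exact pow_ne_zero 2 (by exact_mod_cast this.ne')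
  refine ht.frequently (Eventually.frequently ?_)
  filter_upwards [Ioo_mem_nhdsGT (half_pos Real.pi_pos)] with x hx
  refine hypergeometric_ode_sin_sq hd hΦ ?_
  rw [Complex.ofReal_re, abs_of_pos hx.1]
  exact hx.2

/-- The `n`-th derivative again satisfies a hypergeometric equation. -/
theorem hypergeometric_ode_iteratedDeriv {s : ℂ} {Φ : ℂ → ℂ} {U : Set ℂ} (hU : IsOpen U)
    (hd : DifferentiableOn ℂ Φ U)
    (hode : ∀ w ∈ U, 4 * w * (1 - w) * deriv (deriv Φ) w + 2 * (1 - 2 * w) * deriv Φ w +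
      4 * s ^ 2 * Φ w = 0) (n : ℕ) :
    ∀ w ∈ U, 4 * w * (1 - w) * iteratedDeriv (n + 2) Φ w +
      (4 * n + 2) * (1 - 2 * w) * iteratedDeriv (n + 1) Φ w +
      4 * (s ^ 2 - n ^ 2) * iteratedDeriv n Φ w = 0 := by
  have hdn : ∀ n, DifferentiableOn ℂ (iteratedDeriv n Φ) U := by
    intro n
    induction n with
    | zero => simpa using hd
    | succ n ih => rw [iteratedDeriv_succ]; exact ih.deriv hU
  have hat : ∀ n, ∀ w ∈ U, HasDerivAt (iteratedDeriv n Φ) (iteratedDeriv (n + 1) Φ w) w := by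
    intro n w hw
    rw [iteratedDeriv_succ]
    exact ((hdn n).differentiableAt (hU.mem_nhds hw)).hasDerivAt
  induction n with
  | zero =>
    intro w hw
    simp only [iteratedDeriv_succ, iteratedDeriv_zero, zero_add]
    linear_combination hode w hw
  | succ n ih =>
    intro w hw
    have h1 : HasDerivAt (fun w : ℂ => 4 * w * (1 - w)) (4 * (1 - 2 * w)) w := by
      refine (((hasDerivAt_id w).const_mul 4).mul ((hasDerivAt_id w).const_sub 1)).congr_deriv ?_
      simp only [id]
      ring
    have h2 : HasDerivAt (fun w : ℂ => (4 * n + 2) * (1 - 2 * w)) ((4 * n + 2) * (-2)) w := by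
      refine ((((hasDerivAt_id w).const_mul 2).const_sub 1).const_mul (4 * n + 2 : ℂ)).congr_deriv
        ?_
      ring
    have h3 := (((h1.mul (hat (n + 2) w hw)).add (h2.mul (hat (n + 1) w hw))).add
      ((hat n w hw).const_mul (4 * (s ^ 2 - n ^ 2)))).unique
      ((hasDerivAt_const w (0 : ℂ)).congr_of_eventuallyEq (by
        filter_upwards [hU.mem_nhds hw] with x hx using ih x hx))
    push_cast
    linear_combination h3

theorem ascPochhammer_eval_half_ne_zero (n : ℕ) : (ascPochhammer ℂ n).eval (1 / 2 : ℂ) ≠ 0 := by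
  induction n with
  | zero => simp
  | succ n ih =>
    rw [ascPochhammer_succ_eval]
    refine mul_ne_zero ih fun h => ?_
    have h2 : (2 * n + 1 : ℂ) ≠ 0 := by exact_mod_cast (2 * n).succ_ne_zero
    exact h2 (by linear_combination 2 * h)

/-- The Taylor expansion of `cos (2 s arcsin √w)` is the series `₂F₁(-s, s; 1/2; w)`. -/
theorem hasSum_hypergeometric_cos_arcsin {s : ℂ} {Φ : ℂ → ℂ}
    (hd : DifferentiableOn ℂ Φ slitDomain)
    (hΦ : ∀ θ : ℂ, |θ.re| < Real.pi / 2 → Φ (Complex.sin θ ^ 2) = Complex.cos (2 * s * θ))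
    {w : ℂ} (hw : ‖w‖ < 1) :
    HasSum (fun n : ℕ => hypCoeff [-s, s] [1 / 2] n * w ^ n) (Φ w) := by
  have h0 : (0 : ℂ) ∈ slitDomain := ball_subset_slitDomain (Metric.mem_ball_self one_pos)
  have hcoef : ∀ n : ℕ, (n ! : ℂ)⁻¹ * iteratedDeriv n Φ 0 = hypCoeff [-s, s] [1 / 2] n := by
    have hode := hypergeometric_ode_iteratedDeriv isOpen_slitDomain hd
      (fun w hw => hypergeometric_ode hd hΦ hw)
    have hnn : ∀ n : ℕ, (2 * n + 1 : ℂ) ≠ 0 := fun n => by exact_mod_cast (2 * n).succ_ne_zero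
    intro n
    simp only [hypCoeff, List.map_cons, List.map_nil, List.prod_cons, List.prod_nil, mul_one]
    induction n with
    | zero =>
      have := hΦ 0 (by simpa using half_pos Real.pi_pos)
      simpa using this
    | succ n ih =>
      have hn := hode n 0 h0
      simp only [mul_zero, zero_mul, sub_zero, mul_one, zero_add] at hn
      have hf : (n ! : ℂ) ≠ 0 := by exact_mod_cast n.factorial_ne_zero
      have hn1 : (n + 1 : ℂ) ≠ 0 := by exact_mod_cast n.succ_ne_zero
      have hrec : iteratedDeriv (n + 1) Φ 0 = 2 * (n ^ 2 - s ^ 2) / (2 * n + 1) *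
          iteratedDeriv n Φ 0 := by
        rw [div_mul_eq_mul_div, eq_div_iff (hnn n)]
        linear_combination hn / 2
      have ih' : iteratedDeriv n Φ 0 = n ! * ((ascPochhammer ℂ n).eval (-s) *
          (ascPochhammer ℂ n).eval s / ((ascPochhammer ℂ n).eval (1 / 2) * n !)) := by
        rw [← ih, mul_inv_cancel_left₀ hf]
      have h2 : (1 / 2 + n : ℂ) ≠ 0 := fun h => hnn n (by linear_combination 2 * h)
      rw [hrec, ih', ascPochhammer_succ_eval, ascPochhammer_succ_eval, ascPochhammer_succ_eval,
        Nat.factorial_succ]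
      have hp := ascPochhammer_eval_half_ne_zero n
      have := hnn n
      push_cast
      field_simp
      ring
  have hb : w ∈ Metric.ball (0 : ℂ) 1 := mem_ball_zero_iff.2 hw
  have h := Complex.hasSum_taylorSeries_on_ball (hd.mono ball_subset_slitDomain) hb
  refine h.congr_fun ?_
  intro n
  rw [← hcoef, sub_zero, smul_eq_mul, smul_eq_mul]
  ring

/-! ### The hypergeometric value at `-4` -/

theorem sin_pow_four_mem_Icc (x : ℝ) : Real.sin x ^ 4 ∈ Set.Icc (0 : ℝ) 1 := by
  have h : Real.sin x ^ 4 = (Real.sin x ^ 2) ^ 2 := by ring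
  rw [h]
  exact ⟨by positivity, pow_le_one₀ (sq_nonneg _) (Real.sin_sq_le_one x)⟩

theorem continuous_comp_sin_pow_four_mul {f : ℂ → ℂ} (hf : ContinuousOn f slitDomain) {w : ℂ}
    (hw : w ∈ slitDomain) :
    Continuous fun x : ℝ => f ((Real.sin (Real.pi * x) ^ 4 : ℝ) * w) := by
  refine hf.comp_continuous (by fun_prop) fun x => ?_
  have h := sin_pow_four_mem_Icc (Real.pi * x)
  exact ofReal_mul_mem_slitDomain hw h.1 h.2

/-- Averaging a holomorphic function over the contractions `w ↦ sin⁴(πx) w` of the slit plane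
gives a holomorphic function. -/
theorem differentiableOn_integral_sin_pow_four_mul {f : ℂ → ℂ}
    (hf : DifferentiableOn ℂ f slitDomain) :
    DifferentiableOn ℂ (fun w => ∫ x in (0 : ℝ)..1, f ((Real.sin (Real.pi * x) ^ 4 : ℝ) * w))
      slitDomain := by
  intro w hw
  have hf' : DifferentiableOn ℂ (deriv f) slitDomain := hf.deriv isOpen_slitDomain
  obtain ⟨ε, hε, hball⟩ := Metric.nhds_basis_closedBall.mem_iff.1 (isOpen_slitDomain.mem_nhds hw)
  have hK : IsCompact ((fun p : ℝ × ℂ => (p.1 : ℂ) * p.2) ''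
      (Set.Icc (0 : ℝ) 1 ×ˢ Metric.closedBall w ε)) :=
    (isCompact_Icc.prod (isCompact_closedBall w ε)).image (by fun_prop)
  obtain ⟨M, hM⟩ := hK.exists_bound_of_continuousOn (f := deriv f) (hf'.continuousOn.mono (by
    rintro _ ⟨⟨t, z⟩, ⟨ht, hz⟩, rfl⟩
    exact ofReal_mul_mem_slitDomain (hball hz) ht.1 ht.2))
  have h := intervalIntegral.hasDerivAt_integral_of_dominated_loc_of_deriv_le
    (μ := MeasureTheory.volume) (a := 0) (b := 1) (x₀ := w) (s := Metric.closedBall w ε)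
    (F := fun w (x : ℝ) => f ((Real.sin (Real.pi * x) ^ 4 : ℝ) * w))
    (F' := fun w (x : ℝ) => deriv f ((Real.sin (Real.pi * x) ^ 4 : ℝ) * w) *
      (Real.sin (Real.pi * x) ^ 4 : ℝ))
    (bound := fun _ => M) (Metric.closedBall_mem_nhds w hε)
    (by
      filter_upwards [isOpen_slitDomain.mem_nhds hw] with z hz
      exact (continuous_comp_sin_pow_four_mul hf.continuousOn hz).aestronglyMeasurable)
    ((continuous_comp_sin_pow_four_mul hf.continuousOn hw).intervalIntegrable _ _)
    ((continuous_comp_sin_pow_four_mul hf'.continuousOn hw).mul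
      (by fun_prop)).aestronglyMeasurable
    (by
      refine Eventually.of_forall fun x _ z hz => ?_
      have hx := sin_pow_four_mem_Icc (Real.pi * x)
      have h1 := hM _ ⟨(Real.sin (Real.pi * x) ^ 4, z), ⟨hx, hz⟩, rfl⟩
      rw [norm_mul, Complex.norm_real, Real.norm_of_nonneg hx.1]
      exact (mul_le_of_le_one_right (norm_nonneg _) hx.2).trans h1)
    intervalIntegrable_const
    (by
      refine Eventually.of_forall fun x _ z hz => ?_
      have hx := sin_pow_four_mem_Icc (Real.pi * x)
      have h1 := (hf.differentiableAt (isOpen_slitDomain.mem_nhds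
        (ofReal_mul_mem_slitDomain (hball hz) hx.1 hx.2))).hasDerivAt
      have h2 : HasDerivAt (fun z : ℂ => ((Real.sin (Real.pi * x) ^ 4 : ℝ) : ℂ) * z)
          ((Real.sin (Real.pi * x) ^ 4 : ℝ) : ℂ) z := by
        exact ((hasDerivAt_id z).const_mul _).congr_deriv (mul_one _)
      exact HasDerivAt.comp z h1 h2)
  exact h.2.differentiableAt.differentiableWithinAt

/-- The moments `∫ sin⁴ⁿ(πx) dx` supply the remaining parameters of `₄F₃`. -/
theorem integral_sin_pow_four_mul (n : ℕ) :
    ((∫ x in (0 : ℝ)..1, Real.sin (Real.pi * x) ^ (4 * n) : ℝ) : ℂ) =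
      (ascPochhammer ℂ n).eval (1 / 4) * (ascPochhammer ℂ n).eval (3 / 4) /
        ((ascPochhammer ℂ n).eval (1 / 2) * (ascPochhammer ℂ n).eval 1) := by
  have h1 : ∫ x in (0 : ℝ)..1, Real.sin (Real.pi * x) ^ (4 * n) =
      ∏ i ∈ Finset.range (2 * n), (2 * (i : ℝ) + 1) / (2 * i + 2) := by
    rw [intervalIntegral.integral_comp_mul_left (fun x => Real.sin x ^ (4 * n)) Real.pi_ne_zero,
      mul_zero, mul_one, show 4 * n = 2 * (2 * n) by ring, integral_sin_pow_even, smul_eq_mul,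
      inv_mul_cancel_left₀ Real.pi_ne_zero]
  rw [h1]
  clear h1
  induction n with
  | zero => simp
  | succ n ih =>
    have hn1 : (1 + n : ℂ) ≠ 0 := by
      rw [add_comm]
      exact_mod_cast n.succ_ne_zero
    have hn2 : (1 + 2 * n : ℂ) ≠ 0 := by
      rw [add_comm]
      exact_mod_cast (2 * n).succ_ne_zero
    have hn3 : (1 / 2 + n : ℂ) ≠ 0 := fun h => hn2 (by linear_combination 2 * h)
    have hn4 : (2 * (2 * n) + 2 : ℂ) ≠ 0 := fun h => hn2 (by linear_combination h / 2)
    have hn5 : (2 * (2 * n + 1) + 2 : ℂ) ≠ 0 := fun h => hn1 (by linear_combination h / 4)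
    have hstep : (2 * (2 * n) + 1 : ℂ) / (2 * (2 * n) + 2) *
        ((2 * (2 * n + 1) + 1) / (2 * (2 * n + 1) + 2)) =
        (1 / 4 + n) * (3 / 4 + n) / ((1 / 2 + n) * (1 + n)) := by
      rw [div_mul_div_comm, div_eq_div_iff (mul_ne_zero hn4 hn5) (mul_ne_zero hn3 hn1)]
      ring
    rw [show 2 * (n + 1) = 2 * n + 1 + 1 by ring, Finset.prod_range_succ, Finset.prod_range_succ,
      Complex.ofReal_mul, Complex.ofReal_mul, ih, mul_assoc]
    push_cast
    rw [hstep, div_mul_div_comm]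
    simp only [ascPochhammer_succ_eval]
    congr 1 <;> ring

/-- The parameter `1` below and the factorial of `₄F₃` come from the moments and from `₂F₁`
respectively. -/
theorem hypCoeff_eq_mul_integral (s : ℂ) (n : ℕ) :
    hypCoeff [1 / 4, 3 / 4, -s, s] [1 / 2, 1 / 2, 1] n = hypCoeff [-s, s] [1 / 2] n *
      ((∫ x in (0 : ℝ)..1, Real.sin (Real.pi * x) ^ (4 * n) : ℝ) : ℂ) := by
  rw [integral_sin_pow_four_mul]
  simp only [hypCoeff, List.map_cons, List.map_nil, List.prod_cons, List.prod_nil, mul_one]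
  rw [div_mul_div_comm]
  congr 1 <;> ring

/-- Integrating the series `₂F₁(-s, s; 1/2; sin⁴(πx) w)` of `cos (2 s arcsin √(sin⁴(πx) w))` over
`x` gives the analytic continuation of `₄F₃`; at `w = -4` the integrand becomes
`cosh (2 s arsinh (2 sin² πx))`. -/
theorem exists_isHypContinuation (s : ℂ) :
    ∃ F : ℂ → ℂ, IsHypContinuation [1 / 4, 3 / 4, -s, s] [1 / 2, 1 / 2, 1] F ∧
      limitZeta (2 * s) = (Real.pi : ℂ) * F (-4) := by
  obtain ⟨Φ, hd, hΦ⟩ := exists_differentiableOn_cos_arcsin_sqrt s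
  refine ⟨fun w => ∫ x in (0 : ℝ)..1, Φ ((Real.sin (Real.pi * x) ^ 4 : ℝ) * w),
    ⟨differentiableOn_integral_sin_pow_four_mul hd, fun w hw => ?_⟩, ?_⟩
  · have hsum : Summable fun n : ℕ => ‖hypCoeff [-s, s] [1 / 2] n * w ^ n‖ :=
      (hasSum_hypergeometric_cos_arcsin hd hΦ hw).summable.norm
    have h := intervalIntegral.hasSum_integral_of_dominated_convergence
      (μ := MeasureTheory.volume) (a := 0) (b := 1)
      (F := fun n (x : ℝ) => hypCoeff [-s, s] [1 / 2] n *
        ((Real.sin (Real.pi * x) ^ 4 : ℝ) * w) ^ n)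
      (f := fun x : ℝ => Φ ((Real.sin (Real.pi * x) ^ 4 : ℝ) * w))
      (fun n _ => ‖hypCoeff [-s, s] [1 / 2] n * w ^ n‖)
      (fun n => Continuous.aestronglyMeasurable (by fun_prop))
      (fun n => Eventually.of_forall fun x _ => by
        have hx := sin_pow_four_mem_Icc (Real.pi * x)
        rw [mul_pow, mul_left_comm, norm_mul, norm_pow, Complex.norm_real,
          Real.norm_of_nonneg hx.1]
        exact mul_le_of_le_one_left (norm_nonneg _) (pow_le_one₀ hx.1 hx.2))
      (Eventually.of_forall fun _ _ => hsum) intervalIntegrable_const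
      (Eventually.of_forall fun x _ => hasSum_hypergeometric_cos_arcsin hd hΦ (by
        have hx := sin_pow_four_mem_Icc (Real.pi * x)
        rw [norm_mul, Complex.norm_real, Real.norm_of_nonneg hx.1]
        exact (mul_le_of_le_one_left (norm_nonneg _) hx.2).trans_lt hw))
    refine h.congr_fun fun n => ?_
    have hfun : ∀ x : ℝ, hypCoeff [-s, s] [1 / 2] n *
        ((Real.sin (Real.pi * x) ^ 4 : ℝ) * w) ^ n = (hypCoeff [-s, s] [1 / 2] n * w ^ n) *
        ((Real.sin (Real.pi * x) ^ (4 * n) : ℝ) : ℂ) := fun x => by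
      rw [pow_mul]
      push_cast
      ring
    simp only [hfun]
    rw [intervalIntegral.integral_const_mul, intervalIntegral.integral_ofReal,
      hypCoeff_eq_mul_integral]
    ring
  · have hval : ∀ x : ℝ, Φ ((Real.sin (Real.pi * x) ^ 4 : ℝ) * -4) =
        Complex.cosh (2 * s * (Real.arsinh (2 * Real.sin (Real.pi * x) ^ 2) : ℝ)) := by
      intro x
      set u := Real.arsinh (2 * Real.sin (Real.pi * x) ^ 2) with hu
      have hsinh : Complex.sinh u = ((2 * Real.sin (Real.pi * x) ^ 2 : ℝ) : ℂ) := by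
        rw [← Complex.ofReal_sinh, hu, Real.sinh_arsinh]
      have hre : |((u : ℂ) * Complex.I).re| < Real.pi / 2 := by
        simpa using half_pos Real.pi_pos
      have h := hΦ _ hre
      rw [Complex.sin_mul_I, hsinh, ← mul_assoc, Complex.cos_mul_I] at h
      rw [← h]
      congr 1
      rw [mul_pow, Complex.I_sq]
      push_cast
      ring
    simp only [hval]
    rw [limitZeta, mul_div_cancel_left₀ _ two_ne_zero, limitZ_eq_integral_cosh,
      intervalIntegral.integral_const_mul]
    ring

theorem IsHypContinuation.eqOn {a b : List ℂ} {F G : ℂ → ℂ} (hF : IsHypContinuation a b F)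
    (hG : IsHypContinuation a b G) : Set.EqOn F G slitDomain := by
  refine (DifferentiableOn.analyticOnNhd hF.differentiableOn
    isOpen_slitDomain).eqOn_of_preconnected_of_eventuallyEq
    (DifferentiableOn.analyticOnNhd hG.differentiableOn isOpen_slitDomain)
    isPreconnected_slitDomain (ball_subset_slitDomain (Metric.mem_ball_self one_pos)) ?_
  filter_upwards [Metric.ball_mem_nhds (0 : ℂ) one_pos] with w hw
  rw [mem_ball_zero_iff] at hw
  exact (hF.hasSum w hw).unique (hG.hasSum w hw)

theorem limitZeta_eq_hypergeometric (s : ℂ) :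
    (∃ F : ℂ → ℂ, IsHypContinuation [1 / 4, 3 / 4, -s, s] [1 / 2, 1 / 2, 1] F) ∧
      ∀ F : ℂ → ℂ, IsHypContinuation [1 / 4, 3 / 4, -s, s] [1 / 2, 1 / 2, 1] F →
        limitZeta (2 * s) = (Real.pi : ℂ) * F (-4) := by
  obtain ⟨F, hF, hval⟩ := exists_isHypContinuation s
  refine ⟨⟨F, hF⟩, fun G hG => ?_⟩
  have hmem : (-4 : ℂ) ∈ slitDomain := by
    rintro ⟨h, -⟩
    norm_num at h
  rw [hval, hF.eqOn hG hmem]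

/-! ### Riemann sums -/

/-- Left Riemann sums of a continuous function converge to its integral. -/
theorem tendsto_riemann_sum {g : ℝ → ℂ} (hg : Continuous g) :
    Tendsto (fun n : ℕ => (∑ i ∈ Finset.range n, g (i / n)) / (n : ℂ)) atTop
      (𝓝 (∫ x in (0 : ℝ)..1, g x)) := by
  have hu : UniformContinuousOn g (Set.Icc 0 1) :=
    isCompact_Icc.uniformContinuousOn_of_continuous hg.continuousOn
  rw [Metric.uniformContinuousOn_iff] at hu
  rw [Metric.tendsto_atTop]
  intro ε hε
  obtain ⟨δ, hδ, h⟩ := hu (ε / 2) (half_pos hε)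
  obtain ⟨N, hN⟩ := exists_nat_gt (1 / δ)
  refine ⟨max N 1, fun n hn => ?_⟩
  have hn1 : 1 ≤ n := (le_max_right _ _).trans hn
  have hn0 : (0 : ℝ) < n := by exact_mod_cast hn1
  have hnδ : 1 / (n : ℝ) < δ := by
    have h1 : (N : ℝ) ≤ n := by exact_mod_cast (le_max_left _ _).trans hn
    rw [one_div, inv_lt_comm₀ hn0 hδ, ← one_div]
    linarith
  have hsplit : ∑ i ∈ Finset.range n, ∫ x in ((i : ℕ) / n : ℝ)..((i + 1 : ℕ) / n : ℝ), g x =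
      ∫ x in (0 : ℝ)..1, g x := by
    rw [intervalIntegral.sum_integral_adjacent_intervals (a := fun i : ℕ => (i / n : ℝ))
      fun k _ => hg.intervalIntegrable _ _]
    simp [hn0.ne']
  have hterm : ∀ i ∈ Finset.range n,
      ‖g (i / n) / n - ∫ x in ((i : ℕ) / n : ℝ)..((i + 1 : ℕ) / n : ℝ), g x‖ ≤ ε / 2 * (1 / n) := by
    intro i hi
    have hin : (i : ℝ) + 1 ≤ n := by exact_mod_cast Finset.mem_range.1 hi
    have hlen : ((i + 1 : ℕ) / n : ℝ) - (i : ℕ) / n = 1 / n := by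
      push_cast
      ring
    have hle : (i / n : ℝ) ≤ ((i + 1 : ℕ) / n : ℝ) := by
      have : 0 < 1 / (n : ℝ) := by positivity
      linarith
    have hconst : g (i / n) / n = ∫ _x in ((i : ℕ) / n : ℝ)..((i + 1 : ℕ) / n : ℝ), g (i / n) := by
      rw [intervalIntegral.integral_const, hlen, Complex.real_smul]
      push_cast
      ring
    rw [hconst, ← intervalIntegral.integral_sub (by simp) (hg.intervalIntegrable _ _)]
    have hb := intervalIntegral.norm_integral_le_of_norm_le_const
      (a := ((i : ℕ) / n : ℝ)) (b := ((i + 1 : ℕ) / n : ℝ)) (C := ε / 2)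
      (f := fun x => g (i / n) - g x) (fun x hx => by
        rw [Set.uIoc_of_le hle] at hx
        have h0 : (0 : ℝ) ≤ i / n := by positivity
        have h1 : ((i + 1 : ℕ) / n : ℝ) ≤ 1 := by
          rw [div_le_one hn0]
          push_cast
          exact hin
        rw [← dist_eq_norm]
        refine (h _ ⟨h0, hle.trans h1⟩ x ⟨h0.trans hx.1.le, hx.2.trans h1⟩ ?_).le
        rw [Real.dist_eq, abs_sub_comm, abs_of_pos (by linarith [hx.1])]
        linarith [hx.2])
    rwa [hlen, abs_of_pos (by positivity)] at hb
  rw [dist_eq_norm, ← hsplit, Finset.sum_div, ← Finset.sum_sub_distrib]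
  calc _ ≤ ∑ _i ∈ Finset.range n, ε / 2 * (1 / (n : ℝ)) := norm_sum_le_of_le _ hterm
    _ = ε / 2 := by
      rw [Finset.sum_const, Finset.card_range, nsmul_eq_mul]
      field_simp
    _ < ε := half_lt_self hε

theorem integral_comp_cos_pi_mul_sq {G : ℝ → ℂ} :
    ∫ x in (0 : ℝ)..1, G (Real.cos (Real.pi * x) ^ 2) =
      ∫ x in (0 : ℝ)..1, G (Real.sin (Real.pi * x) ^ 2) := by
  have hp : Function.Periodic (fun x : ℝ => G (Real.sin (Real.pi * x) ^ 2)) 1 := fun x => by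
    simp only [mul_add, mul_one, Real.sin_add_pi, neg_sq]
  have h := hp.intervalIntegral_add_eq (1 / 2) 0
  rw [zero_add] at h
  rw [← h, add_comm (1 / 2 : ℝ) 1]
  have h2 := intervalIntegral.integral_comp_add_right (a := 0) (b := 1)
    (fun x : ℝ => G (Real.sin (Real.pi * x) ^ 2)) (1 / 2)
  rw [zero_add] at h2
  rw [← h2]
  congr 1 with x
  rw [mul_add, mul_one_div, Real.sin_add_pi_div_two]

/-! ### Diagonalising the connection Laplacian of a cycle -/

/-- The simplices of the cycle as subsets of `ZMod n`: the vertex `{k}` for the index `(0, k)` and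
the edge `{k, k + 1}` for `(1, k)`. -/
def circularSimplex {n : ℕ} (p : Fin 2 × ZMod n) : Finset (ZMod n) :=
  if p.1 = 0 then {p.2} else {p.2, p.2 + 1}

/-- The intersection matrix of the simplices of the cycle. -/
def circularMatrix (n : ℕ) (R : Type*) [Zero R] [One R] :
    Matrix (Fin 2 × ZMod n) (Fin 2 × ZMod n) R :=
  Matrix.of fun p q => if Disjoint (circularSimplex p) (circularSimplex q) then 0 else 1

theorem ZMod.one_ne_zero_and_two_ne_zero {n : ℕ} (hn : 3 ≤ n) :
    (1 : ZMod n) ≠ 0 ∧ (2 : ZMod n) ≠ 0 := by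
  constructor
  · intro h
    have h' : ((1 : ℕ) : ZMod n) = 0 := by exact_mod_cast h
    have := Nat.le_of_dvd one_pos ((ZMod.natCast_eq_zero_iff 1 n).1 h')
    omega
  · intro h
    have h' : ((2 : ℕ) : ZMod n) = 0 := by exact_mod_cast h
    have := Nat.le_of_dvd two_pos ((ZMod.natCast_eq_zero_iff 2 n).1 h')
    omega

theorem circularSimplex_injective {n : ℕ} (hn : 3 ≤ n) :
    Function.Injective (circularSimplex (n := n)) := by
  obtain ⟨h1, h2⟩ := ZMod.one_ne_zero_and_two_ne_zero hn
  have key : ∀ j k : ZMod n, ({j} : Finset (ZMod n)) ≠ {k, k + 1} := by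
    intro j k h
    have a := (Finset.ext_iff.1 h k).2 (by simp)
    have b := (Finset.ext_iff.1 h (k + 1)).2 (by simp)
    rw [Finset.mem_singleton] at a b
    exact h1 (by linear_combination b - a)
  rintro ⟨a, j⟩ ⟨b, k⟩ h
  fin_cases a <;> fin_cases b <;> simp [circularSimplex] at h ⊢
  · exact h
  · exact key _ _ h
  · exact key _ _ h.symm
  · have a := (Finset.ext_iff.1 h j).1 (by simp)
    have b := (Finset.ext_iff.1 h (j + 1)).1 (by simp)
    rw [Finset.mem_insert, Finset.mem_singleton] at a b
    rcases a with a | a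
    · exact a
    · rcases b with b | b
      · exact absurd (by linear_combination b - a) h2
      · exact absurd (by linear_combination b - a) h1

theorem exists_equiv_circularComplex {n : ℕ} [NeZero n] (hn : 3 ≤ n) :
    ∃ e : Fin 2 × ZMod n ≃ circularComplex n,
      ∀ p, (e p : Finset ℕ) = (circularSimplex p).image ZMod.val := by
  have hval : ∀ k : ZMod n, (k + 1).val = (k.val + 1) % n := fun k => by
    rw [ZMod.val_add, ZMod.val_one_eq_one_mod, Nat.add_mod_mod]
  have hmem : ∀ p : Fin 2 × ZMod n,
      (circularSimplex p).image ZMod.val ∈ circularComplex n := by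
    rintro ⟨a, k⟩
    have hk : k.val ∈ Finset.range n := Finset.mem_range.2 (ZMod.val_lt k)
    rw [circularComplex, Finset.mem_union, Finset.mem_image, Finset.mem_image]
    fin_cases a
    · exact Or.inl ⟨k.val, hk, by simp [circularSimplex]⟩
    · exact Or.inr ⟨k.val, hk, by simp [circularSimplex, Finset.image_insert, hval]⟩
  refine ⟨Equiv.ofBijective (fun p => ⟨_, hmem p⟩) ⟨fun p q h => ?_, ?_⟩, fun p => rfl⟩
  · exact circularSimplex_injective hn
      (Finset.image_injective (ZMod.val_injective n) (congrArg Subtype.val h))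
  · rintro ⟨x, hx⟩
    rw [circularComplex, Finset.mem_union, Finset.mem_image, Finset.mem_image] at hx
    rcases hx with ⟨k, hk, rfl⟩ | ⟨k, hk, rfl⟩
    · refine ⟨(0, (k : ZMod n)), Subtype.ext ?_⟩
      simp [circularSimplex, ZMod.val_cast_of_lt (Finset.mem_range.1 hk)]
    · refine ⟨(1, (k : ZMod n)), Subtype.ext ?_⟩
      simp [circularSimplex, Finset.image_insert, hval,
        ZMod.val_cast_of_lt (Finset.mem_range.1 hk)]

theorem connectionLaplacian_circularComplex_charpoly {n : ℕ} [NeZero n] (hn : 3 ≤ n) :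
    (connectionLaplacian (circularComplex n) ^ 2).charpoly =
      (circularMatrix n ℝ ^ 2).charpoly := by
  obtain ⟨e, he⟩ := exists_equiv_circularComplex hn
  have h : Matrix.reindex e.symm e.symm (connectionLaplacian (circularComplex n)) =
      circularMatrix n ℝ := by
    ext p q
    simp only [Matrix.reindex_apply, Equiv.symm_symm, Matrix.submatrix_apply, connectionLaplacian,
      circularMatrix, Matrix.of_apply, he, Finset.disjoint_image (ZMod.val_injective n)]
  rw [← h, ← Matrix.charpoly_reindex e.symm]
  congr 1
  exact map_pow (Matrix.reindexAlgEquiv ℝ ℝ e.symm) _ 2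

/-- For `3 ≤ n` the index conditions are mutually exclusive, so the entries are sums of Kronecker
deltas. -/
theorem circularMatrix_apply {n : ℕ} (hn : 3 ≤ n) (j l : ZMod n) :
    circularMatrix n ℂ (0, j) (0, l) = (if l = j then 1 else 0) ∧
    circularMatrix n ℂ (0, j) (1, l) = (if l = j then 1 else 0) + (if l = j - 1 then 1 else 0) ∧
    circularMatrix n ℂ (1, j) (0, l) = (if l = j then 1 else 0) + (if l = j + 1 then 1 else 0) ∧
    circularMatrix n ℂ (1, j) (1, l) = (if l = j then 1 else 0) + (if l = j + 1 then 1 else 0) +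
      (if l = j - 1 then 1 else 0) := by
  obtain ⟨h1, h2⟩ := ZMod.one_ne_zero_and_two_ne_zero hn
  simp only [circularMatrix, circularSimplex, Matrix.of_apply, if_true, one_ne_zero, if_false,
    Finset.disjoint_insert_left, Finset.disjoint_insert_right,
    Finset.disjoint_singleton, Finset.mem_insert, Finset.mem_singleton]
  have e1 : j + 1 ≠ j := fun h => h1 (by linear_combination h)
  have e2 : j - 1 ≠ j := fun h => h1 (by linear_combination -h)
  have e3 : j + 1 ≠ j - 1 := fun h => h2 (by linear_combination h)
  have e4 : j = l ↔ l = j := eq_comm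
  have e5 : j + 1 = l ↔ l = j + 1 := eq_comm
  have e6 : j = l + 1 ↔ l = j - 1 := by rw [eq_sub_iff_add_eq, eq_comm]
  refine ⟨?_, ?_, ?_, ?_⟩ <;> grind

/-- The action of the intersection matrix of the cycle on the Fourier mode `j ↦ χ(j k)`, where
`χ(k) = exp (2πik/n)`, in the basis (mode on vertices, mode on edges). -/
noncomputable def circularBlock {n : ℕ} [NeZero n] (k : ZMod n) : Matrix (Fin 2) (Fin 2) ℂ :=
  !![1, 1 + ZMod.stdAddChar (-k);
    1 + ZMod.stdAddChar k, 1 + ZMod.stdAddChar k + ZMod.stdAddChar (-k)]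

/-- The matrix `(χ(jk))` of the discrete Fourier transform on `ZMod n`, acting separately on vertices and on edges. -/
noncomputable def circularFourier (n : ℕ) [NeZero n] : Matrix (Fin 2 × ZMod n) (Fin 2 × ZMod n) ℂ :=
  Matrix.of fun p q => if p.1 = q.1 then ZMod.stdAddChar (p.2 * q.2) else 0

theorem circularMatrix_mul_circularFourier {n : ℕ} [NeZero n] (hn : 3 ≤ n) :
    circularMatrix n ℂ * circularFourier n =
      circularFourier n * Matrix.blockDiagonal (circularBlock (n := n)) := by
  ext ⟨a, j⟩ ⟨b, k⟩
  obtain ⟨χ, hχ⟩ : ∃ χ : AddChar (ZMod n) ℂ, χ = ZMod.stdAddChar := ⟨_, rfl⟩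
  have hadd : χ (j * k + k) = χ (j * k) * χ k := AddChar.map_add_eq_mul _ _ _
  have hsub : χ ((j - 1) * k) = χ (j * k) * χ (-k) := by
    rw [sub_mul, one_mul, sub_eq_add_neg, AddChar.map_add_eq_mul]
  rw [Matrix.mul_apply, Matrix.mul_apply, Fintype.sum_prod_type, Fintype.sum_prod_type,
    Fin.sum_univ_two, Fin.sum_univ_two]
  simp only [Matrix.blockDiagonal_apply, circularFourier, circularBlock, Matrix.of_apply, ← hχ]
  have h := circularMatrix_apply hn j
  fin_cases a <;> fin_cases b <;>
    simp [(h _).1, (h _).2.1, (h _).2.2.1, (h _).2.2.2, add_mul, Finset.sum_add_distrib, ite_mul,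
      mul_ite, hadd, hsub] <;> ring

theorem exists_mul_circularFourier_eq_one (n : ℕ) [NeZero n] :
    ∃ V, V * circularFourier n = 1 := by
  refine ⟨(n : ℂ)⁻¹ • Matrix.of fun p q : Fin 2 × ZMod n =>
    if p.1 = q.1 then ZMod.stdAddChar (-(p.2 * q.2)) else 0, ?_⟩
  ext ⟨a, j⟩ ⟨b, k⟩
  have hn : (n : ℂ) ≠ 0 := by exact_mod_cast NeZero.ne n
  have hsum : ∑ l : ZMod n, (ZMod.stdAddChar (-(j * l)) * ZMod.stdAddChar (l * k) : ℂ) =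
      if j = k then (n : ℂ) else 0 := by
    have h := AddChar.sum_mulShift (k - j) (ZMod.isPrimitive_stdAddChar n)
    rw [ZMod.card] at h
    simp only [sub_eq_zero, eq_comm (a := k)] at h
    push_cast at h
    rw [← h]
    refine Finset.sum_congr rfl fun l _ => ?_
    rw [← AddChar.map_add_eq_mul]
    congr 1
    ring
  rw [Matrix.smul_mul, Matrix.smul_apply, Matrix.mul_apply, Fintype.sum_prod_type,
    Fin.sum_univ_two, Matrix.one_apply]
  fin_cases a <;> fin_cases b <;> simp [circularFourier, hsum, hn]

theorem charpoly_blockDiagonal {m o R : Type*} [CommRing R] [Fintype m] [DecidableEq m]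
    [Fintype o] [DecidableEq o] (M : o → Matrix m m R) :
    (Matrix.blockDiagonal M).charpoly = ∏ k, (M k).charpoly := by
  rw [Matrix.charpoly, show (Matrix.blockDiagonal M).charmatrix =
    Matrix.blockDiagonal fun k => (M k).charmatrix from ?_, Matrix.det_blockDiagonal]
  · rfl
  · ext1 ⟨i, k⟩ ⟨j, l⟩
    by_cases hkl : k = l
    · subst hkl
      by_cases hij : i = j
      · subst hij
        simp [Matrix.blockDiagonal_apply]
      · simp [Matrix.blockDiagonal_apply, hij]
    · simp [Matrix.blockDiagonal_apply, hkl]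

theorem circularMatrix_sq_charpoly {n : ℕ} [NeZero n] (hn : 3 ≤ n) :
    (circularMatrix n ℂ ^ 2).charpoly = ∏ k : ZMod n, (circularBlock k ^ 2).charpoly := by
  obtain ⟨V, hV⟩ := exists_mul_circularFourier_eq_one n
  have hV' : circularFourier n * V = 1 := mul_eq_one_comm.1 hV
  have hL : circularMatrix n ℂ =
      circularFourier n * (Matrix.blockDiagonal (circularBlock (n := n)) * V) := by
    rw [← mul_assoc, ← circularMatrix_mul_circularFourier hn, mul_assoc, hV', mul_one]
  have hL2 : circularMatrix n ℂ ^ 2 =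
      circularFourier n * (Matrix.blockDiagonal (circularBlock (n := n)) ^ 2 * V) := by
    rw [sq, sq]
    nth_rewrite 2 [hL]
    rw [← mul_assoc, circularMatrix_mul_circularFourier hn, mul_assoc, mul_assoc]
  rw [hL2, Matrix.charpoly_mul_comm, mul_assoc, hV, mul_one, ← Matrix.blockDiagonal_pow,
    charpoly_blockDiagonal]
  rfl

theorem stdAddChar_add_stdAddChar_neg {n : ℕ} [NeZero n] (k : ZMod n) :
    (2 : ℂ) + ZMod.stdAddChar k + ZMod.stdAddChar (-k) =
      ((4 * Real.cos (Real.pi * (k.val / n)) ^ 2 : ℝ) : ℂ) := by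
  have hk : k = ((k.val : ℤ) : ZMod n) := by simp
  have h1 : (ZMod.stdAddChar k : ℂ) = Complex.exp (2 * Real.pi * Complex.I * k.val / n) := by
    conv_lhs => rw [hk]
    rw [ZMod.stdAddChar_coe]
    simp
  have h2 : (ZMod.stdAddChar (-k) : ℂ) = Complex.exp (-(2 * Real.pi * Complex.I * k.val / n)) := by
    rw [AddChar.map_neg_eq_inv, h1, Complex.exp_neg]
  have h3 : Complex.cos (2 * (Real.pi * (k.val / n))) =
      (Complex.exp (2 * Real.pi * Complex.I * k.val / n) +
        Complex.exp (-(2 * Real.pi * Complex.I * k.val / n))) / 2 := by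
    rw [Complex.cos]
    ring_nf
  rw [Complex.cos_two_mul] at h3
  rw [h1, h2]
  push_cast
  linear_combination -2 * h3

/-- Each block `B` has determinant `-1` and trace `y = 4 cos²(πk/n)`, so its eigenvalues are
`f₊(y)` and `f₋(y)`. -/
theorem circularBlock_sq_charpoly {n : ℕ} [NeZero n] (k : ZMod n) :
    (circularBlock k ^ 2).charpoly =
      ((Polynomial.X - Polynomial.C (fPlus (4 * Real.cos (Real.pi * (k.val / n)) ^ 2) ^ 2)) *
        (Polynomial.X - Polynomial.C (fMinus (4 * Real.cos (Real.pi * (k.val / n)) ^ 2) ^ 2))).map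
        Complex.ofRealHom := by
  have ht := stdAddChar_add_stdAddChar_neg k
  set y := 4 * Real.cos (Real.pi * (k.val / n)) ^ 2
  have hχ : (ZMod.stdAddChar k : ℂ) * ZMod.stdAddChar (-k) = 1 := by
    rw [← AddChar.map_add_eq_mul, add_neg_cancel, AddChar.map_zero_eq_one]
  have hs : √(y ^ 2 + 4) ^ 2 = y ^ 2 + 4 := Real.sq_sqrt (by positivity)
  have hsum : fPlus y ^ 2 + fMinus y ^ 2 = y ^ 2 + 2 := by
    rw [fPlus, fMinus]
    linear_combination hs / 2
  have hprod : fPlus y ^ 2 * fMinus y ^ 2 = 1 := by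
    have : fPlus y * fMinus y = -1 := by
      rw [fPlus, fMinus]
      linear_combination -hs / 4
    rw [← mul_pow, this]
    norm_num
  have hsum' : ((fPlus y ^ 2 : ℝ) : ℂ) + ((fMinus y ^ 2 : ℝ) : ℂ) = (y : ℂ) ^ 2 + 2 := by
    exact_mod_cast hsum
  have hprod' : ((fPlus y ^ 2 : ℝ) : ℂ) * ((fMinus y ^ 2 : ℝ) : ℂ) = 1 := by
    exact_mod_cast hprod
  have hdet : (circularBlock k ^ 2).det = 1 := by
    have : (circularBlock k).det = -1 := by
      rw [circularBlock, Matrix.det_fin_two_of]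
      linear_combination -hχ
    rw [Matrix.det_pow, this]
    norm_num
  have htr : (circularBlock k ^ 2).trace = (y : ℂ) ^ 2 + 2 := by
    rw [sq, Matrix.trace_fin_two, circularBlock, Matrix.mul_fin_two, ← ht]
    simp only [Matrix.of_apply, Matrix.cons_val', Matrix.cons_val_zero, Matrix.cons_val_one,
      Matrix.cons_val_fin_one]
    linear_combination 2 * hχ
  rw [Matrix.charpoly_fin_two, hdet, htr, ← hsum']
  simp only [Polynomial.map_mul, Polynomial.map_sub, Polynomial.map_X, Polynomial.map_C,
    Complex.ofRealHom_eq_coe]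
  rw [← hprod', Polynomial.C_mul, Polynomial.C_add]
  ring

theorem circularMatrix_sq_charpoly_real {n : ℕ} [NeZero n] (hn : 3 ≤ n) :
    (circularMatrix n ℝ ^ 2).charpoly = ∏ k : ZMod n,
      ((Polynomial.X - Polynomial.C (fPlus (4 * Real.cos (Real.pi * (k.val / n)) ^ 2) ^ 2)) *
        (Polynomial.X -
          Polynomial.C (fMinus (4 * Real.cos (Real.pi * (k.val / n)) ^ 2) ^ 2))) := by
  apply Polynomial.map_injective Complex.ofRealHom Complex.ofRealHom.injective
  have h : (circularMatrix n ℝ ^ 2).map Complex.ofRealHom = circularMatrix n ℂ ^ 2 := by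
    have h1 : Complex.ofRealHom.mapMatrix (circularMatrix n ℝ) = circularMatrix n ℂ := by
      ext p q
      simp only [circularMatrix, RingHom.mapMatrix_apply, Matrix.map_apply, Matrix.of_apply]
      split_ifs <;> simp
    rw [← h1, ← map_pow]
    rfl
  rw [← Matrix.charpoly_map, h, circularMatrix_sq_charpoly hn, Polynomial.map_prod]
  exact Finset.prod_congr rfl fun k _ => circularBlock_sq_charpoly k

/-- The zeta function of the cycle is a sum of values of one continuous function at the points
`k / n`. -/
theorem circularZeta_eq_sum {n : ℕ} (hn : 3 ≤ n) (s : ℂ) :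
    circularZeta n s = ∑ i ∈ Finset.range n,
      2 * Complex.cosh (2 * s * (Real.arsinh (2 * Real.cos (Real.pi * (i / n)) ^ 2) : ℝ)) := by
  have : NeZero n := ⟨by omega⟩
  have hne : ∀ a b : ℝ,
      (Polynomial.X - Polynomial.C a) * (Polynomial.X - Polynomial.C b) ≠ 0 := fun a b =>
    mul_ne_zero (Polynomial.X_sub_C_ne_zero a) (Polynomial.X_sub_C_ne_zero b)
  rw [circularZeta, spectralZeta, connectionLaplacian_circularComplex_charpoly hn,
    circularMatrix_sq_charpoly_real hn, Polynomial.roots_prod _ _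
      (Finset.prod_ne_zero_iff.2 fun k _ => hne _ _), Multiset.map_bind, Multiset.sum_bind]
  have hk : ∀ k : ZMod n, (Multiset.map (fun l : ℝ => (l : ℂ) ^ (-s)) (Polynomial.roots
      ((Polynomial.X - Polynomial.C (fPlus (4 * Real.cos (Real.pi * (k.val / n)) ^ 2) ^ 2)) *
        (Polynomial.X -
          Polynomial.C (fMinus (4 * Real.cos (Real.pi * (k.val / n)) ^ 2) ^ 2))))).sum =
      2 * Complex.cosh (2 * s * (Real.arsinh (2 * Real.cos (Real.pi * (k.val / n)) ^ 2) : ℝ)) := by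
    intro k
    rw [Polynomial.roots_mul (hne _ _), Polynomial.roots_X_sub_C, Polynomial.roots_X_sub_C,
      Multiset.map_add, Multiset.sum_add, Multiset.map_singleton, Multiset.map_singleton,
      Multiset.sum_singleton, Multiset.sum_singleton, fPlus_cpow_add_fMinus_cpow,
      show ∀ c : ℝ, 4 * c / 2 = 2 * c by intro c; ring, mul_neg, neg_mul, Complex.cosh_neg]
  simp only [hk]
  refine Finset.sum_nbij' (s := Finset.univ) ZMod.val (fun i => (i : ZMod n)) ?_ ?_ ?_ ?_ ?_
  · exact fun k _ => Finset.mem_range.2 (ZMod.val_lt k)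
  · exact fun _ _ => Finset.mem_univ _
  · exact fun k _ => ZMod.natCast_zmod_val k
  · exact fun i hi => ZMod.val_cast_of_lt (Finset.mem_range.1 hi)
  · exact fun k _ => rfl

theorem tendsto_circularZeta_div (s : ℂ) :
    Tendsto (fun n : ℕ => circularZeta n s / (n : ℂ)) atTop (𝓝 (limitZ s)) := by
  have hc : Continuous fun x : ℝ => 2 * Complex.cosh
      (2 * s * (Real.arsinh (2 * Real.cos (Real.pi * x) ^ 2) : ℝ)) := by
    have h : Continuous fun x : ℝ => Real.arsinh (2 * Real.cos (Real.pi * x) ^ 2) :=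
      Real.continuous_arsinh.comp (by fun_prop)
    exact continuous_const.mul (Complex.continuous_cosh.comp (by fun_prop))
  rw [limitZ_eq_integral_cosh, ← integral_comp_cos_pi_mul_sq
    (G := fun v : ℝ => 2 * Complex.cosh (2 * s * (Real.arsinh (2 * v) : ℝ)))]
  refine (tendsto_riemann_sum hc).congr' ?_
  filter_upwards [eventually_ge_atTop 3] with n hn
  rw [circularZeta_eq_sum hn]

/-! ### The limiting zeta function and its explicit forms -/

theorem mainTheorem5 :
    -- the function is the limit of the normalised zeta functions of the circular graphs
    (∀ s : ℂ, Tendsto (fun n : ℕ => circularZeta n s / (n : ℂ)) atTop (𝓝 (limitZ s))) ∧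
    -- a) hypergeometric value at `-4`, by analytic continuation
    (∀ s : ℂ,
      (∃ F : ℂ → ℂ, IsHypContinuation [1 / 4, 3 / 4, -s, s] [1 / 2, 1 / 2, 1] F) ∧
      ∀ F : ℂ → ℂ, IsHypContinuation [1 / 4, 3 / 4, -s, s] [1 / 2, 1 / 2, 1] F →
        limitZeta (2 * s) = (Real.pi : ℂ) * F (-4)) ∧
    -- b) cosine transform of a smooth density
    (ContDiffOn ℝ ∞ cosDensity (Set.Ioo 0 (Real.log (2 + √5))) ∧
      ∀ t : ℂ,
        IntervalIntegrable (fun y : ℝ => Complex.cos (t * (y : ℂ)) * (cosDensity y : ℂ))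
          MeasureTheory.volume 0 (Real.log (2 + √5)) ∧
        limitZeta (Complex.I * t) =
          ∫ y in (0 : ℝ)..Real.log (2 + √5), Complex.cos (t * (y : ℂ)) * (cosDensity y : ℂ)) ∧
    -- c) original expression
    (∀ t : ℂ,
      IntervalIntegrable (fun x : ℝ => 2 * Complex.cos (t * (Real.log
          ((√(4 * Real.sin (Real.pi * x) ^ 4 + 1) + 2 * Real.sin (Real.pi * x) ^ 2) ^ 2) : ℝ)))
        MeasureTheory.volume 0 1 ∧
      limitZ (Complex.I * t) =
        ∫ x in (0 : ℝ)..1, 2 * Complex.cos (t * (Real.log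
          ((√(4 * Real.sin (Real.pi * x) ^ 4 + 1) + 2 * Real.sin (Real.pi * x) ^ 2) ^ 2) : ℝ))) ∧
    -- d) simplest integral
    (∀ t : ℂ,
      IntervalIntegrable (fun v : ℝ =>
          2 * Complex.cos (2 * t * (Real.log (√(4 * v ^ 2 + 1) + 2 * v) : ℝ)) /
            ((Real.pi * √(1 - v) * √v : ℝ) : ℂ))
        MeasureTheory.volume 0 1 ∧
      limitZ (Complex.I * t) =
        ∫ v in (0 : ℝ)..1,
          2 * Complex.cos (2 * t * (Real.log (√(4 * v ^ 2 + 1) + 2 * v) : ℝ)) /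
            ((Real.pi * √(1 - v) * √v : ℝ) : ℂ)) ∧
    -- e) Abelian integral
    (∀ s : ℂ,
      IntervalIntegrable (abelianIntegrand s) MeasureTheory.volume 1 (2 + √5) ∧
      limitZeta s = ∫ z in (1 : ℝ)..(2 + √5), abelianIntegrand s z) := by
  exact ⟨tendsto_circularZeta_div, limitZeta_eq_hypergeometric,
    ⟨contDiffOn_cosDensity, limitZeta_eq_cosine_transform⟩, limitZ_eq_integral_cos_log,
    limitZ_eq_integral_arcsine_density, limitZeta_eq_abelian_integral⟩
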